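/- Write $\mathbb H=\{\tau\in\mathbb C:\operatorname{Im}\tau>0\}$. Let $$K(z)=\int_0^{\pi/2}\frac{d\theta}{\sqrt{1-z\sin^2\theta}},\qquad z\in\mathbb C\setminus[1,\infty),$$ (principal square root) be the main branch of the complete elliptic integral of the first kind and $K'$ its complex derivative. Let $RK_0,IK_0,RK_1,IK_1:\mathbb R^2\to\mathbb R$ be the functions whose values at $(x,y)$ are $\operatorname{Re}K(x+iy)$, $\operatorname{Im}K(x+iy)$, $\operatorname{Re}K'(x+iy)$, $\operatorname{Im}K'(x+iy)$ if $x+iy\notin[1,\infty)$, and $0$ if $x+iy\in[1,\infty)$. Let $$R_K=\langle\mathbb R,\ (r)_{r\in\mathbb R},\ +,\ \cdot,\ -,\ \exp,\ \arctan,\ RK_0,\ RK_1,\ IK_0,\ IK_1\rangle$$ be the expansion of the real field with a constant for each real number and with the unrestricted functions $\exp$ and $\arctan$. A set $X\subseteq\mathbb R^n$ is *strongly definable* in $R_K$ if there are $m\ge 0$ and a quantifier-free formula $\varphi(x_1,\dots,x_n,y_1,\dots,y_m)$ of the language of $R_K$ such that $X=\{a\in\mathbb R^n: R_K\models\exists\bar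 y\,\varphi(a,\bar y)\}$ and, for every $a\in X$, there is a unique $b\in\mathbb R^m$ with $R_K\models\varphi(a,b)$. A function $f:S\to\mathbb C$ with $S\subseteq\mathbb H$ is strongly definable if its graph $\{(\operatorname{Re}\tau,\operatorname{Im}\tau,\operatorname{Re}f(\tau),\operatorname{Im}f(\tau)):\tau\in S\}\subseteq\mathbb R^4$ is strongly definable. Let $\mathcal F=\{\tau\in\mathbb H: |\operatorname{Re}\tau|\le 1,\ |2\tau+1|\ge 1,\ |2\tau-1|\ge 1\}$. Let $$\lambda(\tau)=\left(\frac{\sum_{n\in\mathbb Z}e^{\pi i(n+1/2)^2\tau}}{\sum_{n\in\mathbb Z}e^{\pi i n^2\tau}}\right)^4$$ be the modular lambda function and $j=E_4^3/\Delta$ the modular $j$-function, where $E_4$ is the Eisenstein series of weight $4$ with constant term $1$ and $\Delta=\eta^{24}$ (so $j=q^{-1}+744+\cdots$ with $q=e^{2\pi i\tau}$). Then the restrictions $\lambda|_{\mathcal F}:\mathcal F\to\mathbb C$ and $j|_{\mathcal F}:\mathcal F\to\mathbb C$ are both strongly definable in $R_K$. -/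

import Mathlib

open scoped UpperHalfPlane

/-- `X ⊆ Mⁿ` is strongly definable in the `L`-structure `M`: it is defined by an existential formula
`∃ y₁ … yₘ, φ(x, y)` with `φ` quantifier-free, such that the witness `y` is unique
for every `x ∈ X`. -/
def StronglyDefinable (L : FirstOrder.Language) {M : Type*} [L.Structure M] {n : ℕ}
    (X : Set (Fin n → M)) : Prop :=
  ∃ (m : ℕ) (φ : L.Formula (Fin n ⊕ Fin m)), φ.IsQF ∧
    (∀ a : Fin n → M, a ∈ X ↔ ∃ b : Fin m → M, φ.Realize (Sum.elim a b)) ∧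
    ∀ a ∈ X, ∃! b : Fin m → M, φ.Realize (Sum.elim a b)

noncomputable section

/-- The half-line `[1, ∞)` in the complex plane. -/
def cutRay : Set ℂ := {z | 1 ≤ z.re ∧ z.im = 0}

/-- The main branch of the complete elliptic integral of the first kind,
`∫₀^{π/2} dθ / √(1 - z sin² θ)` with the principal square root. For `z ∉ [1, ∞)` the radicand
avoids `(-∞, 0]`, and this is the analytic continuation of the integral with positive square roots
on `0 < z < 1`. -/
def ellipticIntegralK (z : ℂ) : ℂ :=
  ∫ θ in (0 : ℝ)..(Real.pi / 2), 1 / (1 - z * ((Real.sin θ ^ 2 : ℝ) : ℂ)) ^ (1 / 2 : ℂ)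

open Classical in
/-- `K` on `ℂ \ [1, ∞)`, extended by zero. -/
def ellipticK (z : ℂ) : ℂ := if z ∈ cutRay then 0 else ellipticIntegralK z

open Classical in
/-- The complex derivative `K'` on the open set `ℂ \ [1, ∞)`, extended by zero. -/
def ellipticKDeriv (z : ℂ) : ℂ := if z ∈ cutRay then 0 else deriv ellipticIntegralK z

/-- The function symbols of the language of `R_K`, by arity. -/
inductive RKFunc : ℕ → Type
  | const (r : ℝ) : RKFunc 0
  | add : RKFunc 2
  | mul : RKFunc 2
  | neg : RKFunc 1
  | exp : RKFunc 1
  | arctan : RKFunc 1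
  | reK : RKFunc 2
  | reKDeriv : RKFunc 2
  | imK : RKFunc 2
  | imKDeriv : RKFunc 2

/-- The language of `R_K`; it has no relation symbols besides equality. -/
def RKLang : FirstOrder.Language where
  Functions := RKFunc
  Relations := fun _ => Empty

/-- The interpretation of the function symbols of `R_K`. -/
def RKFunc.interp : {n : ℕ} → RKFunc n → (Fin n → ℝ) → ℝ
  | _, .const r, _ => r
  | _, .add, x => x 0 + x 1
  | _, .mul, x => x 0 * x 1
  | _, .neg, x => -x 0
  | _, .exp, x => Real.exp (x 0)
  | _, .arctan, x => Real.arctan (x 0)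
  | _, .reK, x => (ellipticK ⟨x 0, x 1⟩).re
  | _, .reKDeriv, x => (ellipticKDeriv ⟨x 0, x 1⟩).re
  | _, .imK, x => (ellipticK ⟨x 0, x 1⟩).im
  | _, .imKDeriv, x => (ellipticKDeriv ⟨x 0, x 1⟩).im

/-- The structure `R_K` on the real numbers. -/
instance RKStructure : RKLang.Structure ℝ where
  funMap := fun f x => RKFunc.interp f x
  RelMap := fun r _ => r.elim

/-- The theta constant `θ₂(τ) = ∑_{n ∈ ℤ} exp(π i (n + 1/2)² τ)`. -/
def thetaTwo (τ : ℍ) : ℂ :=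
  ∑' n : ℤ, Complex.exp (Real.pi * Complex.I * ((n : ℂ) + 1 / 2) ^ 2 * (τ : ℂ))

/-- The modular lambda function `λ(τ) = (θ₂(τ) / θ₃(τ))⁴`, where Mathlib's `jacobiTheta` is the theta
constant `θ₃(τ) = ∑_{n ∈ ℤ} exp(π i n² τ)`. -/
def modularLambda (τ : ℍ) : ℂ := (thetaTwo τ / jacobiTheta (τ : ℂ)) ^ 4

/-- The modular `j`-function `j = E₄³ / Δ = q⁻¹ + 744 + …`. -/
def modularJ (τ : ℍ) : ℂ :=
  ModularForm.E₄ τ ^ 3 / ModularForm.discriminant τ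

/-- The set `𝓕 = {τ ∈ ℍ : |Re τ| ≤ 1, |2τ + 1| ≥ 1, |2τ - 1| ≥ 1}`. -/
def fundSet : Set ℍ :=
  {τ | |τ.re| ≤ 1 ∧ 1 ≤ ‖2 * (τ : ℂ) + 1‖ ∧ 1 ≤ ‖2 * (τ : ℂ) - 1‖}

/-- The graph of `f : S → ℂ`, `S ⊆ ℍ`, as a subset of `ℝ⁴`, by real and imaginary parts. -/
def realGraphOn (S : Set ℍ) (f : ℍ → ℂ) : Set (Fin 4 → ℝ) :=
  {p | ∃ τ ∈ S, p = ![τ.re, τ.im, (f τ).re, (f τ).im]}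

end

/-! On the interior of `𝓕` the function `λ` inverts the quotient `z ↦ i K(1 - z) / K(z)`, so its
graph is cut out by one equation between values of `K`. This rests on Jacobi's formula `K(λ(τ)) =
(π/2) θ₃(τ)²` (`ellipticIntegralK_lam`) and on the surjectivity of `λ` from the interior onto the
plane without `(-∞, 0]` and `[1, ∞)` (`exists_mem_fundInterior`). The formula together with `λ(-1/τ)
= 1 - λ(τ)` gives `K(1 - λ) = -iτ K(λ)`. Conversely, if `z` satisfies `K(z) τ = i K(1 - z)`, write
`z = λ(σ)`; since `K(z) ≠ 0`, the same equation for `σ` forces `σ = τ` (`lam_eq_iff`).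

Jacobi's formula is proved on the imaginary axis by Gauss's method: doubling `τ` performs one
arithmetic-geometric mean step on `(θ₃², θ₄²)`, which preserves Gauss's integral, and the pair tends
to `(1, 1)`. The identity theorem then extends the formula. Surjectivity is a topological argument:
`λ` is open, it is real on the sides of the ideal triangle with vertices `0, 1, i∞`, and `λ ~ 16
exp(πiτ)` decides which half-plane is hit; reflection and the imaginary axis supply the rest.

Each side of `𝓕` is carried to the imaginary axis by a modular substitution under which `λ` changes
by an explicit fractional linear map (`graphSide_iff`, `graphCircle_iff`). The five resulting pieces
of the graph are disjoint, so witnesses stay unique in their union; strict inequalities are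
expressed through the injectivity of `exp`. Finally `j` is a rational function of `λ`
(`modularJ_mul`), because `E₄` and `Δ` are symmetric polynomials in the eighth powers of the theta
constants; `λ(τ)` is then a unique auxiliary witness for `j(τ)`. -/

section

open Complex Filter Topology
open scoped Real ComplexConjugate

/-! ### The three theta constants -/

/-- `θ₂` as a function on `ℂ`. -/
noncomputable def theta2 (τ : ℂ) : ℂ := cexp (π * I * τ / 4) * jacobiTheta₂ (τ / 2) τ

/-- `θ₃` as a function on `ℂ`. -/
noncomputable def theta3 (τ : ℂ) : ℂ := jacobiTheta₂ 0 τ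

/-- `θ₄` as a function on `ℂ`. -/
noncomputable def theta4 (τ : ℂ) : ℂ := jacobiTheta₂ (1 / 2) τ

/-- The prefactor `exp(πiτ/4)` completes the square: `n² + n + 1/4 = (n + 1/2)²`. -/
lemma hasSum_theta2 {τ : ℂ} (hτ : 0 < τ.im) :
    HasSum (fun n : ℤ ↦ cexp (π * I * ((n : ℂ) + 1 / 2) ^ 2 * τ)) (theta2 τ) := by
  refine ((hasSum_jacobiTheta₂_term (τ / 2) hτ).mul_left (cexp (π * I * τ / 4))).congr_fun ?_
  intro n
  rw [jacobiTheta₂_term, ← Complex.exp_add]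
  congr 1
  ring

lemma hasSum_theta3 {τ : ℂ} (hτ : 0 < τ.im) :
    HasSum (fun n : ℤ ↦ cexp (π * I * (n : ℂ) ^ 2 * τ)) (theta3 τ) := by
  refine (hasSum_jacobiTheta₂_term 0 hτ).congr_fun ?_
  intro n
  simp [jacobiTheta₂_term]

lemma exp_pi_mul_I_mul_int (n : ℤ) : cexp (π * I * n) = (-1) ^ n := by
  rw [mul_comm, exp_int_mul, exp_pi_mul_I]

lemma hasSum_theta4 {τ : ℂ} (hτ : 0 < τ.im) :
    HasSum (fun n : ℤ ↦ (-1) ^ n * cexp (π * I * (n : ℂ) ^ 2 * τ)) (theta4 τ) := by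
  refine (hasSum_jacobiTheta₂_term (1 / 2) hτ).congr_fun ?_
  intro n
  rw [jacobiTheta₂_term, ← exp_pi_mul_I_mul_int, ← Complex.exp_add]
  congr 1
  ring

lemma thetaTwo_eq (τ : ℍ) : thetaTwo τ = theta2 τ := (hasSum_theta2 τ.im_pos).tsum_eq

lemma jacobiTheta_eq_theta3 (τ : ℂ) : jacobiTheta τ = theta3 τ := jacobiTheta_eq_jacobiTheta₂ τ

/-! ### Transformation under the generators of the modular group -/

lemma neg_I_mul_cpow_ne_zero {τ : ℂ} (hτ : τ ≠ 0) : (-I * τ) ^ (1 / 2 : ℂ) ≠ 0 := by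
  rw [Ne, cpow_eq_zero_iff]
  simp [hτ]

lemma neg_I_mul_cpow_sq (τ : ℂ) : ((-I * τ) ^ (1 / 2 : ℂ)) ^ 2 = -I * τ := by
  rw [← cpow_nat_mul]
  norm_num

lemma theta3_S {τ : ℂ} (hτ : τ ≠ 0) :
    theta3 (-1 / τ) = (-I * τ) ^ (1 / 2 : ℂ) * theta3 τ := by
  have h := jacobiTheta₂_functional_equation 0 τ
  have h0 := neg_I_mul_cpow_ne_zero hτ
  rw [theta3, theta3, h]
  simp only [ne_eq, OfNat.ofNat_ne_zero, not_false_eq_true, zero_pow, mul_zero, zero_div,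
    Complex.exp_zero, mul_one]
  field_simp

/-- The inversion exchanges the half-periods `1/2` and `τ/2`; the Gaussian factor in the functional
equation is absorbed by the prefactor of `theta2`. -/
lemma theta2_S {τ : ℂ} (hτ : τ ≠ 0) :
    theta2 (-1 / τ) = (-I * τ) ^ (1 / 2 : ℂ) * theta4 τ := by
  have h := jacobiTheta₂_functional_equation (1 / 2) τ
  have h0 := neg_I_mul_cpow_ne_zero hτ
  rw [theta2, theta4, h, show (-1 / τ / 2) = -(1 / 2 / τ) by ring, jacobiTheta₂_neg_left,
    show -π * I * (1 / 2) ^ 2 / τ = π * I * (-1 / τ) / 4 by ring]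
  field_simp

lemma theta4_S {τ : ℂ} (hτ : τ ≠ 0) :
    theta4 (-1 / τ) = (-I * τ) ^ (1 / 2 : ℂ) * theta2 τ := by
  have h := jacobiTheta₂_functional_equation (τ / 2) τ
  have h0 := neg_I_mul_cpow_ne_zero hτ
  rw [theta2, theta4, h, show τ / 2 / τ = 1 / 2 by field_simp,
    show -π * I * (τ / 2) ^ 2 / τ = -(π * I * τ / 4) by field_simp; ring, Complex.exp_neg]
  have := Complex.exp_ne_zero (π * I * τ / 4)
  field_simp

lemma exp_pi_mul_I_sq (n : ℤ) : cexp (π * I * (n : ℂ) ^ 2) = (-1) ^ n := by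
  rw [← exp_pi_mul_I_mul_int]
  rw [Complex.exp_eq_exp_iff_exists_int]
  obtain ⟨k, hk⟩ := Int.even_mul_pred_self n
  refine ⟨k, ?_⟩
  have : (n : ℂ) * (n - 1) = k + k := by exact_mod_cast hk
  linear_combination (π * I) * this

lemma theta3_T {τ : ℂ} (hτ : 0 < τ.im) : theta3 (τ + 1) = theta4 τ := by
  refine (hasSum_theta3 (by simpa using hτ)).unique ((hasSum_theta4 hτ).congr_fun fun n ↦ ?_)
  rw [← exp_pi_mul_I_sq, ← Complex.exp_add]
  congr 1
  ring

lemma theta4_T {τ : ℂ} (hτ : 0 < τ.im) : theta4 (τ + 1) = theta3 τ := by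
  refine (hasSum_theta4 (by simpa using hτ)).unique ((hasSum_theta3 hτ).congr_fun fun n ↦ ?_)
  rw [mul_add, mul_one, Complex.exp_add, exp_pi_mul_I_sq, mul_left_comm, ← mul_zpow]
  simp

lemma theta2_T (τ : ℂ) : theta2 (τ + 1) = cexp (π * I / 4) * theta2 τ := by
  rw [theta2, theta2, ← mul_assoc, ← Complex.exp_add,
    show π * I * (τ + 1) / 4 = π * I / 4 + π * I * τ / 4 by ring]
  congr 1
  refine tsum_congr fun n ↦ ?_
  rw [jacobiTheta₂_term, jacobiTheta₂_term, Complex.exp_eq_exp_iff_exists_int]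
  obtain ⟨k, hk⟩ := Int.even_mul_succ_self n
  refine ⟨k, ?_⟩
  have : (n : ℂ) * (n + 1) = k + k := by exact_mod_cast hk
  linear_combination (π * I) * this

lemma exp_pi_mul_I_div_four_pow : cexp (π * I / 4) ^ 4 = -1 := by
  rw [← Complex.exp_nat_mul, ← exp_pi_mul_I]
  congr 1
  push_cast
  ring

/-! ### Duplication formulas and Jacobi's identity -/

/-- Pairs `(m, n)` are split by the parity of `m - n`. In the new coordinates `m² + n²` becomes
diagonal, e.g. `(p + q)² + (p - q)² = 2p² + 2q²`, so products of theta series at `τ` become sums of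
products at `2τ`. -/
lemma HasSum.of_parity {f : ℤ × ℤ → ℂ} {A B : ℂ}
    (hE : HasSum (fun p : ℤ × ℤ ↦ f (p.1 + p.2, p.1 - p.2)) A)
    (hO : HasSum (fun p : ℤ × ℤ ↦ f (p.1 + p.2 + 1, p.1 - p.2)) B) : HasSum f (A + B) := by
  let e : (ℤ × ℤ) ⊕ (ℤ × ℤ) → ℤ × ℤ :=
    Sum.elim (fun p ↦ (p.1 + p.2, p.1 - p.2)) (fun p ↦ (p.1 + p.2 + 1, p.1 - p.2))
  have he : Function.Bijective e := by
    constructor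
    · rintro (⟨a, b⟩ | ⟨a, b⟩) (⟨c, d⟩ | ⟨c, d⟩) h <;>
        simp only [e, Sum.elim_inl, Sum.elim_inr, Prod.mk.injEq] at h
      · simp only [Sum.inl.injEq, Prod.mk.injEq]; omega
      · omega
      · omega
      · simp only [Sum.inr.injEq, Prod.mk.injEq]; omega
    · rintro ⟨m, n⟩
      obtain ⟨k, hk | hk⟩ := Int.even_or_odd' (m - n)
      · exact ⟨Sum.inl (n + k, k), by simp only [e, Sum.elim_inl, Prod.mk.injEq]; omega⟩
      · exact ⟨Sum.inr (n + k, k), by simp only [e, Sum.elim_inr, Prod.mk.injEq]; omega⟩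
  rw [← (Equiv.ofBijective e he).hasSum_iff]
  exact HasSum.sum hE hO

lemma HasSum.mul_prod {f g : ℤ → ℂ} {a b : ℂ} (hf : HasSum f a) (hg : HasSum g b) :
    HasSum (fun p : ℤ × ℤ ↦ f p.1 * g p.2) (a * b) :=
  hf.mul hg (summable_mul_of_summable_norm hf.summable.norm hg.summable.norm)

lemma im_two_mul_pos {τ : ℂ} (hτ : 0 < τ.im) : 0 < (2 * τ).im := by simpa using hτ

lemma theta3_sq {τ : ℂ} (hτ : 0 < τ.im) :
    theta3 τ ^ 2 = theta3 (2 * τ) ^ 2 + theta2 (2 * τ) ^ 2 := by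
  have h3 := hasSum_theta3 (im_two_mul_pos hτ)
  have h2 := hasSum_theta2 (im_two_mul_pos hτ)
  rw [sq, sq, sq]
  refine ((hasSum_theta3 hτ).mul_prod (hasSum_theta3 hτ)).unique (HasSum.of_parity
    ((h3.mul_prod h3).congr_fun fun p ↦ ?_) ((h2.mul_prod h2).congr_fun fun p ↦ ?_)) <;>
  · simp only [← Complex.exp_add]
    congr 1
    push_cast
    ring

/-- The sign `(-1)^(m + n)` is `+1` on the even class and `-1` on the odd class. -/
lemma theta4_sq {τ : ℂ} (hτ : 0 < τ.im) :
    theta4 τ ^ 2 = theta3 (2 * τ) ^ 2 - theta2 (2 * τ) ^ 2 := by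
  have h3 := hasSum_theta3 (im_two_mul_pos hτ)
  have h2 := hasSum_theta2 (im_two_mul_pos hτ)
  rw [sq, sq, sq, sub_eq_add_neg]
  refine ((hasSum_theta4 hτ).mul_prod (hasSum_theta4 hτ)).unique (HasSum.of_parity
    ((h3.mul_prod h3).congr_fun fun p ↦ ?_) ((h2.mul_prod h2).neg.congr_fun fun p ↦ ?_))
  · rw [mul_mul_mul_comm, ← zpow_add₀ (by norm_num),
      show p.1 + p.2 + (p.1 - p.2) = 2 * p.1 by ring, zpow_mul]
    simp only [← Complex.exp_add]
    norm_num
    congr 1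
    ring
  · rw [mul_mul_mul_comm, ← zpow_add₀ (by norm_num),
      show p.1 + p.2 + 1 + (p.1 - p.2) = 2 * p.1 + 1 by ring, zpow_add₀ (by norm_num), zpow_mul]
    simp only [← Complex.exp_add]
    norm_num
    congr 1
    ring

lemma theta2_sq {τ : ℂ} (hτ : 0 < τ.im) :
    theta2 τ ^ 2 = 2 * theta2 (2 * τ) * theta3 (2 * τ) := by
  have h3 := hasSum_theta3 (im_two_mul_pos hτ)
  -- On the odd class the exponent is `2 (p + 1)² + 2 (q + 1/2)²`, hence the shift by one.
  have h3' := (Equiv.addRight (1 : ℤ)).hasSum_iff.mpr h3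
  have h2 := hasSum_theta2 (im_two_mul_pos hτ)
  rw [show 2 * theta2 (2 * τ) * theta3 (2 * τ) =
    theta2 (2 * τ) * theta3 (2 * τ) + theta3 (2 * τ) * theta2 (2 * τ) by ring, sq]
  refine ((hasSum_theta2 hτ).mul_prod (hasSum_theta2 hτ)).unique (HasSum.of_parity
    ((h2.mul_prod h3).congr_fun fun p ↦ ?_) ((h3'.mul_prod h2).congr_fun fun p ↦ ?_)) <;>
  · simp only [← Complex.exp_add, Function.comp, Equiv.coe_addRight]
    congr 1
    push_cast
    ring

/-- Jacobi's identity. -/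
lemma theta_jacobi {τ : ℂ} (hτ : 0 < τ.im) : theta3 τ ^ 4 = theta2 τ ^ 4 + theta4 τ ^ 4 := by
  have h3 := theta3_sq hτ
  have h4 := theta4_sq hτ
  have h2 := theta2_sq hτ
  -- With `x = θ₃(2τ)`, `y = θ₂(2τ)` the claim reads `(x² + y²)² = (2xy)² + (x² - y²)²`.
  rw [show theta3 τ ^ 4 = (theta3 τ ^ 2) ^ 2 by ring,
    show theta4 τ ^ 4 = (theta4 τ ^ 2) ^ 2 by ring,
    show theta2 τ ^ 4 = (theta2 τ ^ 2) ^ 2 by ring, h2, h3, h4]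
  ring

/-! ### Regularity, conjugation, behaviour at the cusp -/

lemma differentiableAt_theta3 {τ : ℂ} (hτ : 0 < τ.im) : DifferentiableAt ℂ theta3 τ :=
  differentiableAt_jacobiTheta₂_snd 0 hτ

lemma differentiableAt_theta4 {τ : ℂ} (hτ : 0 < τ.im) : DifferentiableAt ℂ theta4 τ :=
  differentiableAt_jacobiTheta₂_snd _ hτ

lemma differentiableAt_theta2 {τ : ℂ} (hτ : 0 < τ.im) : DifferentiableAt ℂ theta2 τ := by
  have h := (hasFDerivAt_jacobiTheta₂ (τ / 2) hτ).differentiableAt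
  have h' : DifferentiableAt ℂ (fun τ : ℂ ↦ (τ / 2, τ)) τ := by fun_prop
  have := DifferentiableAt.comp (f := fun τ : ℂ ↦ (τ / 2, τ)) τ h h'
  exact DifferentiableAt.mul (by fun_prop) this

lemma theta3_conj (τ : ℂ) : theta3 (-conj τ) = conj (theta3 τ) := by
  rw [theta3, theta3, jacobiTheta₂_conj, map_zero]

lemma theta2_conj (τ : ℂ) : theta2 (-conj τ) = conj (theta2 τ) := by
  rw [theta2, theta2, map_mul, jacobiTheta₂_conj, ← Complex.exp_conj, neg_div,
    jacobiTheta₂_neg_left]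
  simp [map_ofNat]

lemma tendsto_theta3 : Tendsto theta3 (comap im atTop) (𝓝 1) := by
  have h := isBigO_at_im_infty_jacobiTheta_sub_one
  have h0 : Tendsto (fun τ : ℂ ↦ rexp (-π * τ.im)) (comap im atTop) (𝓝 0) := by
    refine Real.tendsto_exp_atBot.comp ?_
    exact tendsto_comap.const_mul_atTop_of_neg (by simpa using Real.pi_pos)
  have := (h.trans_tendsto h0).add_const 1
  simpa [jacobiTheta_eq_theta3] using this

lemma tendsto_add_one_comap_im : Tendsto (fun τ : ℂ ↦ τ + 1) (comap im atTop) (comap im atTop) := by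
  rw [tendsto_comap_iff]
  simpa [Function.comp_def] using tendsto_comap

lemma eventually_im_pos : ∀ᶠ τ : ℂ in comap im atTop, 0 < τ.im :=
  tendsto_comap.eventually (eventually_gt_atTop 0)

lemma tendsto_theta4 : Tendsto theta4 (comap im atTop) (𝓝 1) := by
  refine (tendsto_theta3.comp tendsto_add_one_comap_im).congr' ?_
  filter_upwards [eventually_im_pos] with τ hτ using theta3_T hτ

/-- The terms have norm `exp(-π n (n + 1) Im τ)`, so only `n = 0` and `n = -1` survive, each
contributing `1`; for `Im τ ≥ 1` the values at `τ = i` dominate. -/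
lemma tendsto_jacobiTheta₂_half :
    Tendsto (fun τ : ℂ ↦ jacobiTheta₂ (τ / 2) τ) (comap im atTop) (𝓝 2) := by
  have hsum : ∑' n : ℤ, (if n = 0 ∨ n = -1 then (1 : ℂ) else 0) = 2 := by
    rw [tsum_eq_sum (s := {0, -1})]
    · rw [Finset.sum_pair (by norm_num)]
      norm_num
    · intro n hn
      simpa using hn
  have hnorm (n : ℤ) (τ : ℂ) :
      ‖jacobiTheta₂_term n (τ / 2) τ‖ = rexp (-π * (n * (n + 1)) * τ.im) := by
    rw [norm_jacobiTheta₂_term]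
    congr 1
    simp
    ring
  have hn0 (n : ℤ) : (0 : ℝ) ≤ n * (n + 1) := by
    rcases le_or_gt 0 n with h | h
    · have : (0 : ℝ) ≤ n := by exact_mod_cast h
      positivity
    · have : (n : ℝ) + 1 ≤ 0 := by exact_mod_cast h
      nlinarith
  suffices Tendsto (fun τ : ℂ ↦ jacobiTheta₂ (τ / 2) τ) (comap im atTop)
      (𝓝 (∑' n : ℤ, (if n = 0 ∨ n = -1 then (1 : ℂ) else 0))) by rwa [hsum] at this
  refine tendsto_tsum_of_dominated_convergence
    (bound := fun n : ℤ ↦ ‖jacobiTheta₂_term n (I / 2) I‖) ?_ ?_ ?_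
  · exact ((summable_jacobiTheta₂_term_iff _ _).mpr (by simp)).norm
  · intro n
    split_ifs with hn
    · refine tendsto_const_nhds.congr fun τ ↦ ?_
      rw [jacobiTheta₂_term]
      rcases hn with rfl | rfl
      · simp
      · rw [eq_comm, Complex.exp_eq_one_iff]
        exact ⟨0, by push_cast; ring⟩
    · rw [tendsto_zero_iff_norm_tendsto_zero]
      simp_rw [hnorm]
      refine Real.tendsto_exp_atBot.comp ?_
      refine tendsto_comap.const_mul_atTop_of_neg ?_
      have : (0 : ℝ) < n * (n + 1) := by
        refine lt_of_le_of_ne (hn0 n) (Ne.symm ?_)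
        push Not at hn
        exact mul_ne_zero (by exact_mod_cast hn.1)
          (by intro h; exact hn.2 (by have : n + 1 = 0 := by exact_mod_cast h
                                      omega))
      nlinarith [Real.pi_pos]
  · filter_upwards [tendsto_comap.eventually (eventually_ge_atTop 1)] with τ hτ n
    rw [hnorm, hnorm]
    refine Real.exp_le_exp.mpr ?_
    simp only [I_im, mul_one]
    have := mul_nonneg Real.pi_pos.le (hn0 n)
    nlinarith

end

section

open Complex Filter Topology
open scoped Real ComplexConjugate

/-! ### Theta constants as modular forms of level one -/

open scoped MatrixGroups Manifold ModularForm

lemma neg_I_mul_cpow_pow_eight (τ : ℂ) : ((-I * τ) ^ (1 / 2 : ℂ)) ^ 8 = τ ^ 4 := by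
  rw [show ((-I * τ) ^ (1 / 2 : ℂ)) ^ 8 = (((-I * τ) ^ (1 / 2 : ℂ)) ^ 2) ^ 4 by ring,
    neg_I_mul_cpow_sq, mul_pow, show (-I) ^ 4 = 1 by rw [neg_pow, I_pow_four]; norm_num, one_mul]

lemma exp_pi_mul_I_div_four_pow_eight : cexp (π * I / 4) ^ 8 = 1 := by
  rw [show 8 = 4 * 2 by norm_num, pow_mul, exp_pi_mul_I_div_four_pow]
  norm_num

lemma slash_S_of_apply {k : ℤ} {f : ℂ → ℂ}
    (hf : ∀ τ : ℂ, τ ≠ 0 → f (-1 / τ) = τ ^ k * f τ) :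
    ((fun τ : ℍ ↦ f τ) ∣[k] ModularGroup.S) = fun τ : ℍ ↦ f τ := by
  ext τ
  rw [ModularForm.SL_slash_apply, UpperHalfPlane.modular_S_smul]
  have h := hf τ τ.ne_zero
  have hτ := τ.ne_zero
  rw [show (-1 / τ : ℂ) = (-τ : ℂ)⁻¹ by field_simp] at h
  have h0 := zpow_ne_zero k hτ
  simp only
  rw [h, show UpperHalfPlane.denom ModularGroup.S τ = τ from ModularGroup.denom_S τ, zpow_neg]
  field_simp

lemma slash_T_of_apply {k : ℤ} {f : ℂ → ℂ} (hf : ∀ τ : ℂ, 0 < τ.im → f (τ + 1) = f τ) :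
    ((fun τ : ℍ ↦ f τ) ∣[k] ModularGroup.T) = fun τ : ℍ ↦ f τ := by
  ext τ
  rw [ModularForm.SL_slash_apply, UpperHalfPlane.modular_T_smul]
  have h : UpperHalfPlane.denom ModularGroup.T τ = 1 := by
    rw [ModularGroup.denom_apply]
    simp [ModularGroup.T]
  rw [h, one_zpow, mul_one, UpperHalfPlane.coe_vadd, ← hf τ τ.im_pos, add_comm]
  simp

lemma mdiff_of_differentiableAt {f : ℂ → ℂ} (hf : ∀ τ : ℂ, 0 < τ.im → DifferentiableAt ℂ f τ) :
    MDiff (fun τ : ℍ ↦ f τ) := by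
  rw [UpperHalfPlane.mdifferentiable_iff]
  refine DifferentiableOn.congr (fun z hz ↦ (hf z hz).differentiableWithinAt) fun z hz ↦ ?_
  simp [UpperHalfPlane.ofComplex_apply_of_im_pos hz]

/-- The product `(θ₂ θ₃ θ₄)⁸`. -/
noncomputable def thetaProd (τ : ℂ) : ℂ := (theta2 τ * theta3 τ * theta4 τ) ^ 8

/-- The sum `θ₂⁸ + θ₃⁸ + θ₄⁸`. -/
noncomputable def thetaSum (τ : ℂ) : ℂ := theta2 τ ^ 8 + theta3 τ ^ 8 + theta4 τ ^ 8

lemma thetaProd_S {τ : ℂ} (hτ : τ ≠ 0) : thetaProd (-1 / τ) = τ ^ 12 * thetaProd τ := by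
  have h := neg_I_mul_cpow_pow_eight τ
  simp only [thetaProd, theta2_S hτ, theta3_S hτ, theta4_S hτ]
  generalize (-I * τ) ^ (1 / 2 : ℂ) = c at h
  -- The first factor is the cofactor of `c⁸ - τ⁴` in `c²⁴ - τ¹²`.
  linear_combination (c ^ 16 + c ^ 8 * τ ^ 4 + τ ^ 8) * (theta2 τ * theta3 τ * theta4 τ) ^ 8 * h

lemma thetaSum_S {τ : ℂ} (hτ : τ ≠ 0) : thetaSum (-1 / τ) = τ ^ 4 * thetaSum τ := by
  have h := neg_I_mul_cpow_pow_eight τ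
  simp only [thetaSum, theta2_S hτ, theta3_S hτ, theta4_S hτ, mul_pow, h]
  ring

lemma thetaProd_T {τ : ℂ} (hτ : 0 < τ.im) : thetaProd (τ + 1) = thetaProd τ := by
  have h := exp_pi_mul_I_div_four_pow_eight
  simp only [thetaProd, theta2_T, theta3_T hτ, theta4_T hτ, mul_pow, h]
  ring

lemma thetaSum_T {τ : ℂ} (hτ : 0 < τ.im) : thetaSum (τ + 1) = thetaSum τ := by
  have h := exp_pi_mul_I_div_four_pow_eight
  simp only [thetaSum, theta2_T, theta3_T hτ, theta4_T hτ, mul_pow, h]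
  ring

lemma tendsto_exp_pi_mul_I_mul :
    Tendsto (fun τ : ℂ ↦ cexp (π * I * τ)) (comap im atTop) (𝓝 0) := by
  rw [tendsto_zero_iff_norm_tendsto_zero]
  have : (fun τ : ℂ ↦ ‖cexp (π * I * τ)‖) = fun τ : ℂ ↦ rexp (-π * τ.im) := by
    ext τ
    rw [Complex.norm_exp]
    simp
  rw [this]
  exact Real.tendsto_exp_atBot.comp
    (tendsto_comap.const_mul_atTop_of_neg (by simpa using Real.pi_pos))

lemma theta2_pow_four (τ : ℂ) :
    theta2 τ ^ 4 = cexp (π * I * τ) * jacobiTheta₂ (τ / 2) τ ^ 4 := by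
  rw [theta2, mul_pow, ← Complex.exp_nat_mul]
  congr 2
  push_cast
  ring

lemma tendsto_theta2_pow_four : Tendsto (fun τ ↦ theta2 τ ^ 4) (comap im atTop) (𝓝 0) := by
  simp_rw [theta2_pow_four]
  simpa using tendsto_exp_pi_mul_I_mul.mul (tendsto_jacobiTheta₂_half.pow 4)

lemma thetaProd_eq (τ : ℂ) : thetaProd τ = cexp (2 * π * I * τ) *
    (jacobiTheta₂ (τ / 2) τ * theta3 τ * theta4 τ) ^ 8 := by
  rw [thetaProd, mul_pow, mul_pow, show theta2 τ ^ 8 = (theta2 τ ^ 4) ^ 2 by ring, theta2_pow_four,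
    mul_pow, ← Complex.exp_nat_mul]
  push_cast
  ring_nf

lemma tendsto_thetaProd_div :
    Tendsto (fun τ ↦ (jacobiTheta₂ (τ / 2) τ * theta3 τ * theta4 τ) ^ 8) (comap im atTop)
      (𝓝 256) := by
  have := ((tendsto_jacobiTheta₂_half.mul tendsto_theta3).mul tendsto_theta4).pow 8
  norm_num at this
  exact this

lemma tendsto_thetaProd : Tendsto thetaProd (comap im atTop) (𝓝 0) := by
  have h : Tendsto (fun τ : ℂ ↦ cexp (2 * π * I * τ)) (comap im atTop) (𝓝 0) := by
    have := tendsto_exp_pi_mul_I_mul.pow 2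
    simp only [← Complex.exp_nat_mul, ne_eq, OfNat.ofNat_ne_zero, not_false_eq_true,
      zero_pow] at this
    refine this.congr fun τ ↦ ?_
    congr 1
    push_cast
    ring
  have := h.mul tendsto_thetaProd_div
  rw [zero_mul] at this
  exact this.congr fun τ ↦ (thetaProd_eq τ).symm

lemma tendsto_thetaSum : Tendsto thetaSum (comap im atTop) (𝓝 2) := by
  have h := ((tendsto_theta2_pow_four.pow 2).add (tendsto_theta3.pow 8)).add (tendsto_theta4.pow 8)
  norm_num at h
  refine h.congr fun τ ↦ ?_
  rw [thetaSum, ← pow_mul]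

/-- `(θ₂ θ₃ θ₄)⁸` as a cusp form of weight 12. -/
noncomputable def thetaProdForm : CuspForm 𝒮ℒ 12 where
  toFun := fun τ : ℍ ↦ thetaProd τ
  slash_action_eq' A hA := by
    obtain ⟨A, rfl⟩ := hA
    exact SlashInvariantForm.slash_action_generators_SL2Z
      (slash_S_of_apply fun τ hτ ↦ by exact_mod_cast thetaProd_S hτ)
      (slash_T_of_apply fun τ hτ ↦ thetaProd_T hτ) A
  holo' := mdiff_of_differentiableAt fun τ hτ ↦ (((differentiableAt_theta2 hτ).mul
    (differentiableAt_theta3 hτ)).mul (differentiableAt_theta4 hτ)).pow 8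
  zero_at_cusps' hc := by
    rw [Subgroup.IsArithmetic.isCusp_iff_isCusp_SL2Z] at hc
    rw [OnePoint.isZeroAt_iff_forall_SL2Z hc]
    intro γ _
    rw [SlashInvariantForm.slash_action_generators_SL2Z
      (slash_S_of_apply fun τ hτ ↦ by exact_mod_cast thetaProd_S hτ)
      (slash_T_of_apply fun τ hτ ↦ thetaProd_T hτ)]
    exact tendsto_thetaProd.comp UpperHalfPlane.tendsto_coe_atImInfty

/-- `θ₂⁸ + θ₃⁸ + θ₄⁸` as a modular form of weight 4. -/
noncomputable def thetaSumForm : ModularForm 𝒮ℒ 4 where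
  toFun := fun τ : ℍ ↦ thetaSum τ
  slash_action_eq' A hA := by
    obtain ⟨A, rfl⟩ := hA
    exact SlashInvariantForm.slash_action_generators_SL2Z
      (slash_S_of_apply fun τ hτ ↦ by exact_mod_cast thetaSum_S hτ)
      (slash_T_of_apply fun τ hτ ↦ thetaSum_T hτ) A
  holo' := mdiff_of_differentiableAt fun τ hτ ↦ (((differentiableAt_theta2 hτ).pow 8).add
    ((differentiableAt_theta3 hτ).pow 8)).add ((differentiableAt_theta4 hτ).pow 8)
  bdd_at_cusps' hc := by
    rw [Subgroup.IsArithmetic.isCusp_iff_isCusp_SL2Z] at hc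
    rw [OnePoint.isBoundedAt_iff_forall_SL2Z hc]
    intro γ _
    rw [SlashInvariantForm.slash_action_generators_SL2Z
      (slash_S_of_apply fun τ hτ ↦ by exact_mod_cast thetaSum_S hτ)
      (slash_T_of_apply fun τ hτ ↦ thetaSum_T hτ)]
    exact (tendsto_thetaSum.comp UpperHalfPlane.tendsto_coe_atImInfty).isBigO_one ℝ

/-- Weight 12 cusp forms of level one are multiples of `Δ`; dividing by `q` and letting `τ → i∞`
gives the constant `2⁸`. -/
lemma thetaProd_eq_discriminant (τ : ℍ) : thetaProd τ = 256 * ModularForm.discriminant τ := by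
  obtain ⟨c, hc⟩ := CuspForm.exists_smul_discriminant_of_weight_eq_twelve thetaProdForm
  have h (z : ℍ) : c * ModularForm.discriminant z = thetaProd z :=
    congrArg (fun f : CuspForm 𝒮ℒ 12 ↦ f z) hc
  have h1 : Tendsto (fun z : ℍ ↦ c * ∏' n, (1 - ModularForm.eta_q n z) ^ 24)
      UpperHalfPlane.atImInfty (𝓝 (c * 1)) :=
    ModularForm.tendsto_atImInfty_tprod_one_sub_eta_q_pow.const_mul c
  have h2 := tendsto_thetaProd_div.comp UpperHalfPlane.tendsto_coe_atImInfty
  have hc' : c * 1 = 256 := by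
    refine tendsto_nhds_unique h1 (h2.congr fun z ↦ ?_)
    have := h z
    rw [ModularForm.discriminant_eq_q_prod, thetaProd_eq, Function.Periodic.qParam] at this
    have he := Complex.exp_ne_zero (2 * π * I * z)
    simp only [ofReal_one, div_one] at this
    rw [mul_left_comm] at this
    exact (mul_left_cancel₀ he this).symm
  rw [← h, ← hc', mul_one]

/-- The space of weight 4 is a line, and the constant terms are `0 + 1 + 1 = 2` and `1`. -/
lemma thetaSum_eq_E₄ (τ : ℍ) : thetaSum τ = 2 * ModularForm.E₄ τ := by
  have hE : (UpperHalfPlane.qExpansion 1 ModularForm.E₄).coeff 0 = 1 :=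
    EisensteinSeries.E_qExpansion_coeff_zero (by norm_num) ⟨2, rfl⟩
  have hE0 : ModularForm.E₄ ≠ 0 := EisensteinSeries.E_ne_zero _ ⟨2, rfl⟩
  obtain ⟨c, hc⟩ := (finrank_eq_one_iff_of_nonzero' _ hE0).mp
    (Module.rank_eq_one_iff_finrank_eq_one.mp ModularForm.levelOne_weight_four_rank_one)
    thetaSumForm
  have hlim : (UpperHalfPlane.qExpansion 1 thetaSumForm).coeff 0 = 2 := by
    rw [UpperHalfPlane.qExpansion_coeff_zero one_pos
      (ModularFormClass.analyticAt_cuspFunction_zero _ one_pos one_mem_strictPeriods_SL)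
      (SlashInvariantFormClass.periodic_comp_ofComplex _ one_mem_strictPeriods_SL)]
    exact (tendsto_thetaSum.comp UpperHalfPlane.tendsto_coe_atImInfty).limUnder_eq
  rw [← hc, FunLike.coe_smul, ModularForm.qExpansion_smul one_pos one_mem_strictPeriods_SL,
    PowerSeries.coeff_smul, hE, smul_eq_mul, mul_one] at hlim
  rw [← hlim]
  exact (congrArg (fun f : ModularForm 𝒮ℒ 4 ↦ f τ) hc).symm

/-! ### Nonvanishing and the modular functions `λ` and `j` -/

/-- A zero of any factor would be a zero of `Δ`. -/
lemma theta_ne_zero {τ : ℂ} (hτ : 0 < τ.im) : theta2 τ ≠ 0 ∧ theta3 τ ≠ 0 ∧ theta4 τ ≠ 0 := by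
  have h := thetaProd_eq_discriminant ⟨τ, hτ⟩
  have h0 : thetaProd τ ≠ 0 := by
    rw [UpperHalfPlane.coe_mk] at h
    rw [h]
    exact mul_ne_zero (by norm_num) (ModularForm.discriminant_ne_zero _)
  refine ⟨?_, ?_, ?_⟩ <;>
  · intro h
    simp [thetaProd, h] at h0

lemma theta2_ne_zero {τ : ℂ} (hτ : 0 < τ.im) : theta2 τ ≠ 0 := (theta_ne_zero hτ).1

lemma theta3_ne_zero {τ : ℂ} (hτ : 0 < τ.im) : theta3 τ ≠ 0 := (theta_ne_zero hτ).2.1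

lemma theta4_ne_zero {τ : ℂ} (hτ : 0 < τ.im) : theta4 τ ≠ 0 := (theta_ne_zero hτ).2.2

/-- The modular lambda function on `ℂ`. -/
noncomputable def lam (τ : ℂ) : ℂ := (theta2 τ / theta3 τ) ^ 4

lemma modularLambda_eq (τ : ℍ) : modularLambda τ = lam τ := by
  rw [modularLambda, thetaTwo_eq, jacobiTheta_eq_theta3, lam]

lemma one_sub_lam {τ : ℂ} (hτ : 0 < τ.im) : 1 - lam τ = (theta4 τ / theta3 τ) ^ 4 := by
  have h3 := theta3_ne_zero hτ
  rw [lam, div_pow, div_pow, eq_div_iff (pow_ne_zero _ h3), sub_mul, one_mul,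
    div_mul_cancel₀ _ (pow_ne_zero _ h3), theta_jacobi hτ]
  ring

lemma lam_ne_zero {τ : ℂ} (hτ : 0 < τ.im) : lam τ ≠ 0 :=
  pow_ne_zero _ (div_ne_zero (theta2_ne_zero hτ) (theta3_ne_zero hτ))

lemma one_sub_lam_ne_zero {τ : ℂ} (hτ : 0 < τ.im) : 1 - lam τ ≠ 0 := by
  rw [one_sub_lam hτ]
  exact pow_ne_zero _ (div_ne_zero (theta4_ne_zero hτ) (theta3_ne_zero hτ))

lemma lam_T {τ : ℂ} (hτ : 0 < τ.im) : lam (τ + 1) * (lam τ - 1) = lam τ := by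
  have h3 := theta3_ne_zero hτ
  have h4 := theta4_ne_zero hτ
  rw [show lam τ - 1 = -(1 - lam τ) by ring, one_sub_lam hτ, lam, lam, theta2_T, theta3_T hτ,
    div_pow, mul_pow, exp_pi_mul_I_div_four_pow]
  field_simp

lemma lam_S {τ : ℂ} (hτ : 0 < τ.im) : lam (-1 / τ) = 1 - lam τ := by
  have h0 : τ ≠ 0 := by
    rintro rfl
    simp at hτ
  rw [one_sub_lam hτ, lam, theta2_S h0, theta3_S h0,
    mul_div_mul_left _ _ (neg_I_mul_cpow_ne_zero h0)]

lemma lam_conj (τ : ℂ) : lam (-conj τ) = conj (lam τ) := by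
  simp [lam, theta2_conj, theta3_conj]

lemma differentiableAt_lam {τ : ℂ} (hτ : 0 < τ.im) : DifferentiableAt ℂ lam τ :=
  ((differentiableAt_theta2 hτ).div (differentiableAt_theta3 hτ) (theta3_ne_zero hτ)).pow 4

/-- `j λ² (1 - λ)² = 256 (1 - λ + λ²)³`. -/
lemma modularJ_mul (τ : ℍ) : modularJ τ * (lam τ ^ 2 * (1 - lam τ) ^ 2) =
    256 * (1 - lam τ + lam τ ^ 2) ^ 3 := by
  have hD := thetaProd_eq_discriminant τ
  have hE := thetaSum_eq_E₄ τ
  have hJ := theta_jacobi τ.im_pos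
  have h2 := theta2_ne_zero τ.im_pos
  have h3 := theta3_ne_zero τ.im_pos
  have h4 := theta4_ne_zero τ.im_pos
  have hE' : ModularForm.E₄ τ = thetaSum τ / 2 := by rw [hE]; ring
  have hD' : ModularForm.discriminant τ = thetaProd τ / 256 := by rw [hD]; ring
  rw [modularJ, hE', hD', one_sub_lam τ.im_pos, lam, thetaSum, thetaProd]
  generalize theta2 (τ : ℂ) = a at *
  generalize theta3 (τ : ℂ) = b at *
  generalize theta4 (τ : ℂ) = c at *
  -- The last factor is `1 - λ + λ²`; Jacobi's identity `b⁴ = a⁴ + c⁴` makes the two sides agree.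
  have : a ^ 8 + b ^ 8 + c ^ 8 = 2 * b ^ 8 * ((c / b) ^ 4 + ((a / b) ^ 4) ^ 2) := by
    field_simp
    linear_combination (b ^ 4 + a ^ 4 - c ^ 4) * hJ
  rw [this]
  field_simp

end

section

open Complex Filter Topology
open scoped Real ComplexConjugate

/-! ### The arithmetic-geometric mean and Gauss's integral -/

open MeasureTheory Set

/-- Gauss's integral. -/
noncomputable def gaussIntegral (a b : ℝ) : ℝ :=
  ∫ θ in (0 : ℝ)..(π / 2), 1 / √(a ^ 2 * Real.cos θ ^ 2 + b ^ 2 * Real.sin θ ^ 2)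

/-- Substitution `t = b tan θ`. The algebraic form is the one suited to Gauss's change of variables.
-/
lemma integral_Ioi_eq_gaussIntegral {a b : ℝ} (ha : 0 < a) (hb : 0 < b) :
    ∫ t in Ioi (0 : ℝ), 1 / √((a ^ 2 + t ^ 2) * (b ^ 2 + t ^ 2)) = gaussIntegral a b := by
  have himg : (fun θ ↦ b * Real.tan θ) '' Ioo 0 (π / 2) = Ioi 0 := by
    ext t
    constructor
    · rintro ⟨θ, hθ, rfl⟩
      exact mul_pos hb (Real.tan_pos_of_pos_of_lt_pi_div_two hθ.1 hθ.2)
    · intro ht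
      refine ⟨Real.arctan (t / b), ⟨?_, Real.arctan_lt_pi_div_two _⟩, ?_⟩
      · rw [Real.arctan_pos]
        exact div_pos ht hb
      · simp only [Real.tan_arctan]
        field_simp
  have hinj : InjOn (fun θ ↦ b * Real.tan θ) (Ioo 0 (π / 2)) := by
    intro x hx y hy hxy
    refine Real.injOn_tan ⟨?_, hx.2⟩ ⟨?_, hy.2⟩ (mul_left_cancel₀ hb.ne' hxy)
    · linarith [hx.1, Real.pi_pos]
    · linarith [hy.1, Real.pi_pos]
  have hder : ∀ θ ∈ Ioo 0 (π / 2), HasDerivWithinAt (fun θ ↦ b * Real.tan θ)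
      (b * (1 / Real.cos θ ^ 2)) (Ioo 0 (π / 2)) θ := by
    intro θ hθ
    have hc : Real.cos θ ≠ 0 :=
      (Real.cos_pos_of_mem_Ioo ⟨by linarith [hθ.1, Real.pi_pos], hθ.2⟩).ne'
    exact ((Real.hasDerivAt_tan hc).const_mul b).hasDerivWithinAt
  rw [← himg, integral_image_eq_integral_abs_deriv_smul measurableSet_Ioo hder hinj,
    gaussIntegral, intervalIntegral.integral_of_le (by positivity),
    integral_Ioc_eq_integral_Ioo]
  refine setIntegral_congr_fun measurableSet_Ioo fun θ hθ ↦ ?_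
  have hc : 0 < Real.cos θ := Real.cos_pos_of_mem_Ioo ⟨by linarith [hθ.1, Real.pi_pos], hθ.2⟩
  have hs : Real.sin θ ^ 2 = 1 - Real.cos θ ^ 2 := by
    have := Real.sin_sq_add_cos_sq θ
    linarith
  have key : (a ^ 2 + (b * Real.tan θ) ^ 2) * (b ^ 2 + (b * Real.tan θ) ^ 2) =
      (a ^ 2 * Real.cos θ ^ 2 + b ^ 2 * Real.sin θ ^ 2) * (b / Real.cos θ ^ 2) ^ 2 := by
    rw [Real.tan_eq_sin_div_cos]
    field_simp
    rw [hs]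
    ring
  have hpos : 0 < a ^ 2 * Real.cos θ ^ 2 + b ^ 2 * Real.sin θ ^ 2 := by positivity
  simp only [smul_eq_mul]
  rw [key, Real.sqrt_mul hpos.le, Real.sqrt_sq (by positivity), abs_of_pos (by positivity)]
  have := Real.sqrt_pos.mpr hpos
  field_simp

/-- Gauss's transformation. -/
lemma gaussIntegral_agm {a b c : ℝ} (ha : 0 < a) (hb : 0 < b) (hc : 0 < c) (habc : c ^ 2 = a * b) :
    gaussIntegral ((a + b) / 2) c = gaussIntegral a b := by
  -- The substitution `u = (t - ab/t)/2` maps `(0, ∞)` bijectively onto `ℝ`; the even integrand on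
  -- `ℝ` accounts for a factor `2`.
  have hinj : InjOn (fun t ↦ (t - a * b / t) / 2) (Ioi 0) := by
    intro x hx y hy hxy
    have hx : 0 < x := hx
    have hy : 0 < y := hy
    simp only at hxy
    field_simp at hxy
    have : (x - y) * (x * y + a * b) = 0 := by linear_combination hxy
    rcases mul_eq_zero.mp this with h | h
    · linarith
    · have : 0 < x * y + a * b := by positivity
      linarith
  have himg : (fun t ↦ (t - a * b / t) / 2) '' Ioi 0 = univ := by
    rw [eq_univ_iff_forall]
    intro u
    have hab : 0 < a * b := mul_pos ha hb
    have hlt : |u| < √(u ^ 2 + a * b) := by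
      rw [← Real.sqrt_sq_eq_abs]
      exact Real.sqrt_lt_sqrt (sq_nonneg _) (by linarith)
    have hsq := Real.sq_sqrt (show 0 ≤ u ^ 2 + a * b by positivity)
    have hpos : 0 < u + √(u ^ 2 + a * b) := by linarith [neg_abs_le u]
    refine ⟨u + √(u ^ 2 + a * b), hpos, ?_⟩
    simp only
    field_simp
    linear_combination hsq
  have hder : ∀ t ∈ Ioi (0 : ℝ), HasDerivWithinAt (fun t ↦ (t - a * b / t) / 2)
      ((1 - (0 * t - a * b * 1) / t ^ 2) / 2) (Ioi 0) t := by
    intro t ht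
    exact (((hasDerivAt_id t).sub (((hasDerivAt_const t (a * b)).div (hasDerivAt_id t)
      (ne_of_gt ht)))).div_const 2).hasDerivWithinAt
  have hsymm : ∫ u : ℝ, 1 / √((((a + b) / 2) ^ 2 + u ^ 2) * (c ^ 2 + u ^ 2)) =
      2 * gaussIntegral ((a + b) / 2) c := by
    rw [← integral_Ioi_eq_gaussIntegral (by positivity) hc, ← integral_comp_abs]
    simp only [sq_abs]
  have h := integral_image_eq_integral_abs_deriv_smul measurableSet_Ioi hder hinj
    (fun u ↦ 1 / √((((a + b) / 2) ^ 2 + u ^ 2) * (c ^ 2 + u ^ 2)))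
  rw [himg, setIntegral_univ, hsymm] at h
  have h2 : ∫ t in Ioi (0 : ℝ), |(1 - (0 * t - a * b * 1) / t ^ 2) / 2| •
      (1 / √((((a + b) / 2) ^ 2 + ((t - a * b / t) / 2) ^ 2) *
        (c ^ 2 + ((t - a * b / t) / 2) ^ 2))) =
      ∫ t in Ioi (0 : ℝ), 2 * (1 / √((a ^ 2 + t ^ 2) * (b ^ 2 + t ^ 2))) := by
    refine setIntegral_congr_fun measurableSet_Ioi fun t ht ↦ ?_
    have ht : 0 < t := ht
    -- Here `c² + u² = ((t + ab/t)/2)²` and `((a + b)/2)² + u² = (a² + t²)(b² + t²)/(4t²)`.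
    have key : (((a + b) / 2) ^ 2 + ((t - a * b / t) / 2) ^ 2) *
        (c ^ 2 + ((t - a * b / t) / 2) ^ 2) =
        ((a ^ 2 + t ^ 2) * (b ^ 2 + t ^ 2)) * ((t ^ 2 + a * b) / (4 * t ^ 2)) ^ 2 := by
      rw [habc]
      field_simp
      ring
    have hd : (1 - (0 * t - a * b * 1) / t ^ 2) / 2 = 2 * ((t ^ 2 + a * b) / (4 * t ^ 2)) := by
      field_simp
      ring
    have hpos : 0 < (a ^ 2 + t ^ 2) * (b ^ 2 + t ^ 2) := by positivity
    have hpos' : 0 < (t ^ 2 + a * b) / (4 * t ^ 2) := by positivity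
    simp only [smul_eq_mul]
    rw [key, hd, Real.sqrt_mul hpos.le, Real.sqrt_sq hpos'.le, abs_of_pos (by positivity)]
    have := Real.sqrt_pos.mpr hpos
    generalize (t ^ 2 + a * b) / (4 * t ^ 2) = d at hpos'
    field_simp
  rw [h2, integral_const_mul, integral_Ioi_eq_gaussIntegral ha hb] at h
  linarith

lemma gaussIntegrand_pos {a b : ℝ} (ha : 0 < a) (hb : 0 < b) (θ : ℝ) :
    0 < a ^ 2 * Real.cos θ ^ 2 + b ^ 2 * Real.sin θ ^ 2 := by
  have h := Real.sin_sq_add_cos_sq θ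
  by_cases hc : Real.cos θ = 0
  · rw [hc] at h ⊢
    have : Real.sin θ ^ 2 = 1 := by linarith
    rw [this]
    positivity
  · positivity

lemma continuous_gaussIntegrand {a b : ℝ} (ha : 0 < a) (hb : 0 < b) :
    Continuous fun θ ↦ 1 / √(a ^ 2 * Real.cos θ ^ 2 + b ^ 2 * Real.sin θ ^ 2) := by
  refine continuous_const.div (by fun_prop) fun θ ↦ ?_
  exact (Real.sqrt_pos.mpr (gaussIntegrand_pos ha hb θ)).ne'

lemma le_gaussIntegral {a b : ℝ} (hb : 0 < b) (hab : b ≤ a) :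
    π / 2 * (1 / a) ≤ gaussIntegral a b := by
  have ha := hb.trans_le hab
  have : ∫ θ in (0 : ℝ)..(π / 2), 1 / a ≤ gaussIntegral a b := by
    refine intervalIntegral.integral_mono_on (by positivity) (by simp)
      ((continuous_gaussIntegrand ha hb).intervalIntegrable _ _) fun θ _ ↦ ?_
    refine one_div_le_one_div_of_le (Real.sqrt_pos.mpr (gaussIntegrand_pos ha hb θ)) ?_
    rw [Real.sqrt_le_left ha.le]
    have h := Real.sin_sq_add_cos_sq θ
    nlinarith [sq_nonneg (Real.sin θ), mul_self_le_mul_self hb.le hab]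
  simpa using this

lemma gaussIntegral_le {a b : ℝ} (hb : 0 < b) (hab : b ≤ a) :
    gaussIntegral a b ≤ π / 2 * (1 / b) := by
  have ha := hb.trans_le hab
  have : gaussIntegral a b ≤ ∫ θ in (0 : ℝ)..(π / 2), 1 / b := by
    refine intervalIntegral.integral_mono_on (by positivity)
      ((continuous_gaussIntegrand ha hb).intervalIntegrable _ _) (by simp) fun θ _ ↦ ?_
    refine one_div_le_one_div_of_le hb ?_
    rw [Real.le_sqrt' hb]
    have h := Real.sin_sq_add_cos_sq θ
    nlinarith [sq_nonneg (Real.cos θ), mul_self_le_mul_self hb.le hab]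
  simpa using this

/-! ### Theta constants on the imaginary axis -/

lemma ofReal_mul_I_im_pos {t : ℝ} (ht : 0 < t) : 0 < (t * I : ℂ).im := by simpa using ht

lemma exists_pos_ofReal_of_hasSum {f : ℤ → ℝ} {s : ℂ} (hf : ∀ n, 0 < f n)
    (h : HasSum (fun n ↦ (f n : ℂ)) s) : ∃ r : ℝ, 0 < r ∧ s = r := by
  have hs : Summable f := by
    have := h.summable
    exact_mod_cast this
  refine ⟨∑' n, f n, hs.tsum_pos (fun n ↦ (hf n).le) 0 (hf 0), ?_⟩
  rw [ofReal_tsum]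
  exact h.tsum_eq.symm

lemma theta2_mul_I {t : ℝ} (ht : 0 < t) : ∃ r : ℝ, 0 < r ∧ theta2 (t * I) = r := by
  refine exists_pos_ofReal_of_hasSum (f := fun n : ℤ ↦ rexp (-π * (n + 1 / 2) ^ 2 * t))
    (fun n ↦ Real.exp_pos _) ((hasSum_theta2 (ofReal_mul_I_im_pos ht)).congr_fun fun n ↦ ?_)
  push_cast
  congr 1
  linear_combination (-π * ((n : ℂ) + 1 / 2) ^ 2 * t) * I_sq

lemma theta3_mul_I {t : ℝ} (ht : 0 < t) : ∃ r : ℝ, 0 < r ∧ theta3 (t * I) = r := by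
  refine exists_pos_ofReal_of_hasSum (f := fun n : ℤ ↦ rexp (-π * n ^ 2 * t))
    (fun n ↦ Real.exp_pos _) ((hasSum_theta3 (ofReal_mul_I_im_pos ht)).congr_fun fun n ↦ ?_)
  push_cast
  congr 1
  linear_combination (-π * (n : ℂ) ^ 2 * t) * I_sq

lemma neg_one_div_mul_I (t : ℝ) : -1 / (t * I) = (t⁻¹ : ℝ) * I := by
  rw [div_eq_mul_inv, mul_inv, Complex.inv_I]
  push_cast
  ring

/-- The series alternates, so positivity is transported from `θ₂(i/t)` by the inversion. -/
lemma theta4_mul_I {t : ℝ} (ht : 0 < t) : ∃ r : ℝ, 0 < r ∧ theta4 (t * I) = r := by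
  obtain ⟨r, hr, h⟩ := theta2_mul_I (inv_pos.mpr ht)
  have h0 : (t * I : ℂ) ≠ 0 := by simp [ht.ne']
  have hS := theta2_S h0
  have hI : -I * (t * I) = (t : ℂ) := by linear_combination (-t : ℂ) * I_sq
  rw [neg_one_div_mul_I, h, hI, show (1 / 2 : ℂ) = ((1 / 2 : ℝ) : ℂ) by push_cast; ring,
    ← ofReal_cpow ht.le] at hS
  have hp : 0 < t ^ (1 / 2 : ℝ) := Real.rpow_pos_of_pos ht _
  refine ⟨r / t ^ (1 / 2 : ℝ), by positivity, ?_⟩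
  push_cast
  rw [hS]
  have : ((t ^ (1 / 2 : ℝ) : ℝ) : ℂ) ≠ 0 := by exact_mod_cast hp.ne'
  field_simp

/-- By the duplication formulas `θ₃(2τ)²` and `θ₄(2τ)²` are the arithmetic and geometric means of
`θ₃(τ)²` and `θ₄(τ)²`. -/
lemma gaussIntegral_theta_double {t a b a' b' : ℝ} (ht : 0 < t) (ha : 0 < a) (hb : 0 < b)
    (hb' : 0 < b') (h3 : theta3 (t * I) = a) (h4 : theta4 (t * I) = b)
    (h3' : theta3 ((2 * t : ℝ) * I) = a') (h4' : theta4 ((2 * t : ℝ) * I) = b') :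
    gaussIntegral (a' ^ 2) (b' ^ 2) = gaussIntegral (a ^ 2) (b ^ 2) := by
  have him := ofReal_mul_I_im_pos ht
  have him' := ofReal_mul_I_im_pos (show 0 < 2 * t by positivity)
  have e3 := theta3_sq him
  have e4 := theta4_sq him
  have eJ := theta_jacobi him'
  rw [show (2 * (t * I) : ℂ) = (2 * t : ℝ) * I by push_cast; ring] at e3 e4
  have h1 : (a' ^ 2 : ℝ) = (a ^ 2 + b ^ 2) / 2 := by
    rw [h3, h3'] at e3
    rw [h4, h3'] at e4
    have : (a' ^ 2 : ℂ) = (a ^ 2 + b ^ 2) / 2 := by linear_combination (-e3 - e4) / 2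
    exact_mod_cast this
  have h2 : (b' ^ 2) ^ 2 = a ^ 2 * b ^ 2 := by
    have : (b' ^ 2 : ℂ) ^ 2 = a ^ 2 * b ^ 2 := by
      rw [← h3, ← h4, ← h4', e3, e4]
      linear_combination -eJ
    exact_mod_cast this
  rw [h1]
  exact gaussIntegral_agm (by positivity) (by positivity) (by positivity) h2

lemma tendsto_mul_I_comap_im : Tendsto (fun t : ℝ ↦ (t * I : ℂ)) atTop (comap im atTop) := by
  rw [tendsto_comap_iff]
  simpa [Function.comp_def] using! tendsto_id (α := ℝ)

/-- The integral is unchanged along `2ⁿ t`, where both theta values tend to `1`; the elementary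
bounds squeeze it to `π/2`. -/
lemma gaussIntegral_theta {t a b : ℝ} (ht : 0 < t)
    (h3 : theta3 (t * I) = a) (h4 : theta4 (t * I) = b) :
    gaussIntegral (a ^ 2) (b ^ 2) = π / 2 := by
  have ht' (n : ℕ) : 0 < 2 ^ n * t := by positivity
  choose A hA hA3 using fun n ↦ theta3_mul_I (ht' n)
  choose B hB hB4 using fun n ↦ theta4_mul_I (ht' n)
  have hconst (n : ℕ) : gaussIntegral (A n ^ 2) (B n ^ 2) = gaussIntegral (a ^ 2) (b ^ 2) := by
    induction n with
    | zero =>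
      have e3 := hA3 0
      have e4 := hB4 0
      rw [pow_zero, one_mul, h3] at e3
      rw [pow_zero, one_mul, h4] at e4
      rw [ofReal_injective e3, ofReal_injective e4]
    | succ n ih =>
      rw [← ih]
      refine gaussIntegral_theta_double (ht' n) (hA n) (hB n) (hB (n + 1)) (hA3 n) (hB4 n) ?_ ?_
      · rw [← hA3 (n + 1), pow_succ']
        ring_nf
      · rw [← hB4 (n + 1), pow_succ']
        ring_nf
  have hBA (n : ℕ) : B n ^ 2 ≤ A n ^ 2 := by
    obtain ⟨r, hr, h2⟩ := theta2_mul_I (ht' n)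
    have hJ := theta_jacobi (ofReal_mul_I_im_pos (ht' n))
    rw [hA3, hB4, h2] at hJ
    have hJ' : A n ^ 4 = r ^ 4 + B n ^ 4 := by exact_mod_cast hJ
    refine le_of_sq_le_sq ?_ (sq_nonneg _)
    nlinarith [pow_pos hr 4]
  have hlim : Tendsto (fun n : ℕ ↦ ((2 ^ n * t : ℝ) * I : ℂ)) atTop (comap im atTop) :=
    tendsto_mul_I_comap_im.comp
      ((tendsto_pow_atTop_atTop_of_one_lt one_lt_two).atTop_mul_const ht)
  have hre : Tendsto Complex.re (𝓝 1) (𝓝 1) := by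
    simpa using Complex.continuous_re.tendsto 1
  have hAlim : Tendsto A atTop (𝓝 1) :=
    (hre.comp (tendsto_theta3.comp hlim)).congr fun n ↦ by
      simp only [Function.comp, hA3, ofReal_re]
  have hBlim : Tendsto B atTop (𝓝 1) :=
    (hre.comp (tendsto_theta4.comp hlim)).congr fun n ↦ by
      simp only [Function.comp, hB4, ofReal_re]
  have hl : Tendsto (fun n ↦ π / 2 * (1 / A n ^ 2)) atTop (𝓝 (π / 2)) := by
    simpa using ((hAlim.pow 2).inv₀ (by norm_num)).const_mul (π / 2)
  have hu : Tendsto (fun n ↦ π / 2 * (1 / B n ^ 2)) atTop (𝓝 (π / 2)) := by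
    simpa using ((hBlim.pow 2).inv₀ (by norm_num)).const_mul (π / 2)
  refine le_antisymm (ge_of_tendsto' hu fun n ↦ ?_) (le_of_tendsto' hl fun n ↦ ?_)
  · rw [← hconst n]
    exact gaussIntegral_le (pow_pos (hB n) 2) (hBA n)
  · rw [← hconst n]
    exact le_gaussIntegral (pow_pos (hB n) 2) (hBA n)

/-- Jacobi's formula `K(λ(τ)) = (π / 2) θ₃(τ)²` on the imaginary axis. -/
lemma ellipticIntegralK_lam_mul_I {t : ℝ} (ht : 0 < t) :
    ellipticIntegralK (lam (t * I)) = π / 2 * theta3 (t * I) ^ 2 := by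
  obtain ⟨a, ha, h3⟩ := theta3_mul_I ht
  obtain ⟨b, hb, h4⟩ := theta4_mul_I ht
  have hlam := one_sub_lam (ofReal_mul_I_im_pos ht)
  rw [h3, h4] at hlam
  have key (θ : ℝ) : 1 / (1 - lam (t * I) * ((Real.sin θ ^ 2 : ℝ) : ℂ)) ^ (1 / 2 : ℂ) =
      ((a ^ 2 * (1 / √((a ^ 2) ^ 2 * Real.cos θ ^ 2 + (b ^ 2) ^ 2 * Real.sin θ ^ 2)) : ℝ) : ℂ) := by
    have hpos := gaussIntegrand_pos (pow_pos ha 2) (pow_pos hb 2) θ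
    -- Since `1 - λ = (θ₄/θ₃)⁴`, the radicand is `cos² θ + (θ₄/θ₃)⁴ sin² θ`.
    have hz : (1 - lam (t * I) * ((Real.sin θ ^ 2 : ℝ) : ℂ)) =
        ((((a ^ 2) ^ 2 * Real.cos θ ^ 2 + (b ^ 2) ^ 2 * Real.sin θ ^ 2) / (a ^ 2) ^ 2 : ℝ) : ℂ) := by
      have e : lam (t * I) = 1 - ((b / a : ℝ) : ℂ) ^ 4 := by
        push_cast
        rw [← hlam]
        ring
      rw [e]
      norm_cast
      rw [div_pow]
      field_simp
      rw [Real.cos_sq']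
      ring
    rw [hz, show (1 / 2 : ℂ) = ((1 / 2 : ℝ) : ℂ) by push_cast; ring, ← ofReal_cpow (by positivity),
      ← Real.sqrt_eq_rpow, Real.sqrt_div hpos.le, Real.sqrt_sq (by positivity)]
    norm_cast
    have := Real.sqrt_pos.mpr hpos
    field_simp
  rw [ellipticIntegralK]
  simp_rw [key]
  rw [intervalIntegral.integral_ofReal, intervalIntegral.integral_const_mul]
  have := gaussIntegral_theta ht h3 h4
  rw [gaussIntegral] at this
  rw [this, h3]
  push_cast
  ring

end

section

open Complex Filter Topology
open scoped Real ComplexConjugate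

/-! ### Geometry of the modular lambda function -/

open Set

lemma theta2_add_two (τ : ℂ) : theta2 (τ + 2) ^ 4 = theta2 τ ^ 4 := by
  rw [show τ + 2 = τ + 1 + 1 by ring, theta2_T, theta2_T]
  linear_combination (cexp (π * I / 4) ^ 4 - 1) * theta2 τ ^ 4 * exp_pi_mul_I_div_four_pow

lemma lam_add_two (τ : ℂ) : lam (τ + 2) = lam τ := by
  rw [lam, lam, div_pow, div_pow, theta2_add_two, theta3, theta3, jacobiTheta₂_add_right]

lemma lam_eq_exp_mul (τ : ℂ) :
    lam τ = cexp (π * I * τ) * (jacobiTheta₂ (τ / 2) τ / theta3 τ) ^ 4 := by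
  rw [lam, div_pow, theta2_pow_four, div_pow, mul_div_assoc]

lemma tendsto_lam_div_exp :
    Tendsto (fun τ : ℂ ↦ (jacobiTheta₂ (τ / 2) τ / theta3 τ) ^ 4) (comap im atTop) (𝓝 16) := by
  have := (tendsto_jacobiTheta₂_half.div tendsto_theta3 one_ne_zero).pow 4
  norm_num at this
  exact this

lemma tendsto_lam : Tendsto lam (comap im atTop) (𝓝 0) := by
  have := tendsto_exp_pi_mul_I_mul.mul tendsto_lam_div_exp
  rw [zero_mul] at this
  exact this.congr fun τ ↦ (lam_eq_exp_mul τ).symm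

lemma qParam_two (τ : ℂ) : Function.Periodic.qParam 2 τ = cexp (π * I * τ) := by
  rw [Function.Periodic.qParam]
  congr 1
  push_cast
  ring

lemma periodic_lam : Function.Periodic lam ((2 : ℝ) : ℂ) := by
  intro τ
  rw [ofReal_ofNat, lam_add_two]

/-- As a function of `q = exp(πiτ)`, `λ` extends holomorphically over `q = 0` with `λ = 16q + …`.
Strict differentiability is needed in order to compare two nearby points, `q` and its conjugate. -/
lemma hasStrictDerivAt_cuspFunction_lam :
    HasStrictDerivAt (Function.Periodic.cuspFunction 2 lam) 16 0 := by
  have hhol : ∀ᶠ τ in comap im atTop, DifferentiableAt ℂ lam τ :=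
    eventually_im_pos.mono fun τ hτ ↦ differentiableAt_lam hτ
  have h0 : Function.Periodic.cuspFunction 2 lam 0 = 0 :=
    Function.Periodic.cuspFunction_zero_of_zero_at_inf two_pos tendsto_lam
  have hd0 := Function.Periodic.differentiableAt_cuspFunction_zero two_pos periodic_lam hhol
    (tendsto_lam.isBigO_one ℝ)
  have hd : ∀ᶠ q in 𝓝 0, DifferentiableAt ℂ (Function.Periodic.cuspFunction 2 lam) q :=
    eventually_nhdsWithin_iff.mp
      (Function.Periodic.eventually_differentiableAt_cuspFunction_nhds_ne_zero two_pos
        periodic_lam hhol) |>.mono fun q hq ↦ by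
          by_cases h : q = 0
          · exact h ▸ hd0
          · exact hq h
  have han : AnalyticAt ℂ (Function.Periodic.cuspFunction 2 lam) 0 :=
    Complex.analyticAt_iff_eventually_differentiableAt.mpr hd
  have hder : HasDerivAt (Function.Periodic.cuspFunction 2 lam) 16 0 := by
    rw [hasDerivAt_iff_tendsto_slope]
    refine (tendsto_lam_div_exp.comp
      (Function.Periodic.invQParam_tendsto two_pos)).congr' ?_
    filter_upwards [self_mem_nhdsWithin] with q hq
    have hq : q ≠ 0 := hq
    have h1 : cexp (π * I * Function.Periodic.invQParam 2 q) = q := by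
      rw [← qParam_two, Function.Periodic.qParam_right_inv two_ne_zero hq]
    rw [slope_def_field, h0, Function.Periodic.cuspFunction_eq_of_nonzero _ _ hq,
      lam_eq_exp_mul, h1]
    simp only [Function.comp]
    field_simp
    ring
  rw [← hder.deriv]
  exact han.hasStrictDerivAt

/-- Near the cusp `i∞`, `λ` maps the half-strip `0 < Re τ < 1` to the upper half-plane. -/
lemma eventually_lam_im_pos :
    ∀ᶠ τ : ℂ in comap im atTop, 0 < τ.re → τ.re < 1 → 0 < (lam τ).im := by
  -- Applied to `q` and `conj q`, this yields `|2 Im λ - 32 Im q| ≤ 2 Im q`, and `Im q > 0` in the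
  -- half-strip.
  have hstrict := hasStrictDerivAt_cuspFunction_lam.isLittleO.def one_pos
  have ht1 := tendsto_exp_pi_mul_I_mul
  have hconj : Tendsto (fun τ : ℂ ↦ -conj τ) (comap im atTop) (comap im atTop) := by
    rw [tendsto_comap_iff]
    simpa [Function.comp_def] using tendsto_comap
  have ht2 := ht1.comp hconj
  have ht := ht1.prodMk_nhds ht2
  filter_upwards [ht.eventually hstrict] with τ hτ h0 h1
  have hG (σ : ℂ) : Function.Periodic.cuspFunction 2 lam (cexp (π * I * σ)) = lam σ := by
    rw [← qParam_two, Function.Periodic.eq_cuspFunction two_ne_zero periodic_lam]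
  simp only [Function.comp, hG, lam_conj] at hτ
  have hq : cexp (π * I * -conj τ) = conj (cexp (π * I * τ)) := by
    rw [← Complex.exp_conj]
    simp
  rw [hq] at hτ
  set q := cexp (π * I * τ) with hqdef
  have hqim : 0 < q.im := by
    rw [hqdef, Complex.exp_im]
    refine mul_pos (Real.exp_pos _) (Real.sin_pos_of_pos_of_lt_pi ?_ ?_)
    · simpa using mul_pos Real.pi_pos h0
    · simpa using mul_lt_of_lt_one_right Real.pi_pos h1
  have e1 : lam τ - conj (lam τ) = ((2 * (lam τ).im : ℝ) : ℂ) * I := by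
    rw [Complex.sub_conj]
  have e2 : q - conj q = ((2 * q.im : ℝ) : ℂ) * I := by
    rw [Complex.sub_conj]
  rw [e1, e2] at hτ
  have e3 : ((2 * (lam τ).im : ℝ) : ℂ) * I - (ContinuousLinearMap.toSpanSingleton ℂ (16 : ℂ))
      (((2 * q.im : ℝ) : ℂ) * I) = ((2 * (lam τ).im - 32 * q.im : ℝ) : ℂ) * I := by
    simp
    ring
  rw [e3] at hτ
  rw [norm_mul, norm_mul, norm_I, mul_one, mul_one, norm_real, norm_real, Real.norm_eq_abs,
    Real.norm_eq_abs, one_mul, abs_of_pos (by positivity : 0 < 2 * q.im)] at hτ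
  linarith [(abs_le.mp hτ).1]

/-- The ideal triangle with vertices `0`, `1`, `i∞`. -/
def idealTriangle : Set ℂ := {τ | 0 < τ.im ∧ 0 < τ.re ∧ τ.re < 1 ∧ τ.re < normSq τ}

lemma isOpen_idealTriangle : IsOpen idealTriangle := by
  refine (isOpen_lt continuous_const continuous_im).inter
    ((isOpen_lt continuous_const continuous_re).inter
      ((isOpen_lt continuous_re continuous_const).inter (isOpen_lt continuous_re ?_)))
  exact continuous_normSq

/-! ### Boundary values of `λ` on the ideal triangle -/

lemma lam_im_eq_zero_of_re_zero {τ : ℂ} (h : τ.re = 0) : (lam τ).im = 0 := by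
  have e : -conj τ = τ := by apply Complex.ext <;> simp [h]
  have := lam_conj τ
  rw [e] at this
  exact conj_eq_iff_im.mp this.symm

lemma lam_im_eq_zero_of_re_one {τ : ℂ} (h : τ.re = 1) : (lam τ).im = 0 := by
  have e : -conj τ + 2 = τ := by
    apply Complex.ext
    · simp [h]; norm_num
    · simp
  have := lam_conj τ
  rw [← lam_add_two, e] at this
  exact conj_eq_iff_im.mp this.symm

lemma neg_one_div_re (τ : ℂ) : (-1 / τ).re = -τ.re / normSq τ := by
  rw [neg_div, one_div, neg_re, inv_re, neg_div]

lemma neg_one_div_im (τ : ℂ) : (-1 / τ).im = τ.im / normSq τ := by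
  rw [neg_div, one_div, neg_im, inv_im, neg_div, neg_neg]

lemma normSq_pos_of_im_pos {τ : ℂ} (h : 0 < τ.im) : 0 < normSq τ := by
  rw [normSq_apply]
  nlinarith [mul_self_nonneg τ.re]

lemma neg_one_div_im_pos {τ : ℂ} (h : 0 < τ.im) : 0 < (-1 / τ).im := by
  rw [neg_one_div_im]
  exact div_pos h (normSq_pos_of_im_pos h)

/-- The inversion carries this circle to the line `Re = -1`, and `λ(-1/τ) = 1 - λ(τ)`. -/
lemma lam_im_eq_zero_of_circle {τ : ℂ} (h0 : 0 < τ.im) (h : τ.re = normSq τ) : (lam τ).im = 0 := by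
  have e : (-1 / τ + 2).re = 1 := by
    rw [add_re, neg_one_div_re, h, neg_div, div_self (normSq_pos_of_im_pos h0).ne']
    norm_num
  have := lam_im_eq_zero_of_re_one e
  rw [lam_add_two, lam_S h0] at this
  simpa using this

/-- If `τ → 0` inside the region `|Re τ| (1 - |Re τ|) ≤ (Im τ)²`, then `-1/τ → i∞`. -/
lemma tendsto_neg_one_div_of_cusp {l : Filter ℂ} (hl : l ≤ 𝓝 0)
    (h : ∀ᶠ τ in l, 0 < τ.im ∧ |τ.re| * (1 - |τ.re|) ≤ τ.im ^ 2) :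
    Tendsto (fun τ ↦ -1 / τ) l (comap im atTop) := by
  rw [tendsto_comap_iff]
  have him : Tendsto (fun τ : ℂ ↦ τ.im) l (𝓝[>] 0) := by
    refine tendsto_nhdsWithin_iff.mpr ⟨?_, h.mono fun τ hτ ↦ hτ.1⟩
    exact (continuous_im.tendsto 0).mono_left hl
  have hre : ∀ᶠ τ in l, |τ.re| < 1 / 2 := by
    have : Tendsto (fun τ : ℂ ↦ |τ.re|) l (𝓝 0) := by
      have h := (continuous_re.abs.tendsto (0 : ℂ)).mono_left hl
      simpa using h
    exact this.eventually (gt_mem_nhds (by norm_num))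
  have him1 : ∀ᶠ τ in l, τ.im < 1 :=
    (him.mono_right nhdsWithin_le_nhds).eventually (gt_mem_nhds one_pos)
  have hinv : Tendsto (fun τ : ℂ ↦ 1 / 5 * (τ.im)⁻¹) l atTop :=
    (tendsto_inv_nhdsGT_zero.comp him).const_mul_atTop (by norm_num)
  refine tendsto_atTop_mono' _ ?_ hinv
  filter_upwards [h, hre, him1] with τ hτ h1 h2
  obtain ⟨hpos, hτ⟩ := hτ
  simp only [Function.comp, neg_one_div_im]
  -- From `|Re τ| < 1/2` follows `|Re τ| ≤ 2 (Im τ)²`; with `Im τ < 1` this gives `|τ|² ≤ (4 + 1)(Im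
  -- τ)²`, so `Im(-1/τ) ≥ 1/(5 Im τ)`.
  have hn : normSq τ ≤ 5 * τ.im ^ 2 := by
    rw [normSq_apply, ← abs_mul_abs_self τ.re]
    have h0 := abs_nonneg τ.re
    have h3 : |τ.re| ≤ 2 * τ.im ^ 2 := by nlinarith
    have h4 : |τ.re| * |τ.re| ≤ 4 * τ.im ^ 4 := by nlinarith
    have h5 : τ.im ^ 4 ≤ τ.im ^ 2 := by
      have : τ.im ^ 2 ≤ 1 := by nlinarith
      nlinarith [sq_nonneg τ.im]
    nlinarith
  rw [← div_eq_mul_inv, div_div, div_le_div_iff₀ (by positivity) (normSq_pos_of_im_pos hpos)]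
  linarith

/-- Limit points of the values of `λ` on the ideal triangle come from the cusps or the closure of
the triangle. -/
lemma lam_limit_idealTriangle {l : Ultrafilter ℂ} {z : ℂ} (hT : ∀ᶠ τ in l, τ ∈ idealTriangle)
    (hz : Tendsto lam l (𝓝 z)) :
    ((l : Filter ℂ) ≤ comap im atTop ∧ z = 0) ∨ z = 1 ∨
      ∃ τ : ℂ, 0 < τ.im ∧ 0 ≤ τ.re ∧ τ.re ≤ 1 ∧ τ.re ≤ normSq τ ∧ lam τ = z := by
  by_cases hM : ∀ M : ℝ, ∀ᶠ τ : ℂ in l, M < τ.im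
  · left
    have hle : (l : Filter ℂ) ≤ comap im atTop := by
      rw [← tendsto_id', tendsto_comap_iff]
      exact tendsto_atTop.mpr fun M ↦ (hM M).mono fun τ hτ ↦ le_of_lt hτ
    exact ⟨hle, tendsto_nhds_unique hz (tendsto_lam.mono_left hle)⟩
  right
  push Not at hM
  obtain ⟨M, hM⟩ := hM
  have hcomp : IsCompact (Icc (0 : ℝ) 1 ×ℂ Icc (0 : ℝ) M) := isCompact_Icc.reProdIm isCompact_Icc
  have hmem : ∀ᶠ τ in l, τ ∈ Icc (0 : ℝ) 1 ×ℂ Icc (0 : ℝ) M := by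
    filter_upwards [hT, hM] with τ h1 h2
    rw [mem_reProdIm]
    exact ⟨⟨h1.2.1.le, h1.2.2.1.le⟩, ⟨h1.1.le, h2⟩⟩
  obtain ⟨τ₀, hτ₀, hlim⟩ := hcomp.ultrafilter_le_nhds l (le_principal_iff.mpr hmem)
  rw [mem_reProdIm] at hτ₀
  have hnorm : τ₀.re ≤ normSq τ₀ :=
    le_of_tendsto_of_tendsto ((continuous_re.tendsto τ₀).mono_left hlim)
      ((continuous_normSq.tendsto τ₀).mono_left hlim) (hT.mono fun τ hτ ↦ hτ.2.2.2.le)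
  rcases hτ₀.2.1.lt_or_eq with him | him
  · right
    refine ⟨τ₀, him, hτ₀.1.1, hτ₀.1.2, hnorm, ?_⟩
    exact tendsto_nhds_unique ((differentiableAt_lam him).continuousAt.mono_left hlim) hz
  · left
    -- A real limit point `x ∈ [0, 1]` satisfies `x ≤ x²`, hence is one of the cusps `0` and `1`.
    have hsq : τ₀.re ≤ τ₀.re * τ₀.re := by simpa [normSq_apply, ← him] using hnorm
    have h01 : τ₀.re = 0 ∨ τ₀.re = 1 := by
      rcases hτ₀.1.1.lt_or_eq with h | h
      · right
        have h1 := hτ₀.1.2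
        nlinarith
      · exact Or.inl h.symm
    rcases h01 with h | h
    · have e : τ₀ = 0 := Complex.ext h him.symm
      subst e
      have hc := tendsto_neg_one_div_of_cusp hlim (hT.mono fun τ hτ ↦ ⟨hτ.1, by
        obtain ⟨h1, h2, h3, h4⟩ := hτ
        rw [abs_of_pos h2]
        rw [normSq_apply] at h4
        nlinarith⟩)
      have h1 := tendsto_lam.comp hc
      have h2 : Tendsto (fun τ ↦ 1 - lam τ) l (𝓝 (1 - z)) := hz.const_sub 1
      have h3 := tendsto_nhds_unique (h1.congr' (hT.mono fun τ hτ ↦ lam_S hτ.1)) h2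
      exact (sub_eq_zero.mp h3.symm).symm
    -- At the cusp `1`, `λ(τ - 1) → 1`, and `λ(τ)(λ(τ - 1) - 1) = λ(τ - 1)` is incompatible with a
    -- finite limit of `λ(τ)`.
    · exfalso
      have e : τ₀ = 1 := Complex.ext h him.symm
      subst e
      have hsub : Tendsto (fun τ : ℂ ↦ τ - 1) l (𝓝 0) := by
        have h := (tendsto_id' (α := ℂ)).mpr hlim
        simpa using h.sub_const (1 : ℂ)
      have hc := tendsto_neg_one_div_of_cusp hsub (eventually_map.mpr
        (hT.mono fun τ hτ ↦ ⟨by simpa using hτ.1, by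
          obtain ⟨h1, h2, h3, h4⟩ := hτ
          rw [normSq_apply] at h4
          simp only [sub_re, one_re, sub_im, one_im, sub_zero]
          rw [abs_of_neg (by linarith)]
          nlinarith⟩))
      have h1 : Tendsto (fun τ : ℂ ↦ lam (-1 / (τ - 1))) l (𝓝 0) :=
        tendsto_lam.comp (tendsto_map'_iff.mp hc)
      have him' : ∀ᶠ τ : ℂ in l, 0 < (τ - 1).im := hT.mono fun τ hτ ↦ by simpa using hτ.1
      have h2 : Tendsto (fun τ : ℂ ↦ 1 - lam (-1 / (τ - 1))) l (𝓝 (1 - 0)) := h1.const_sub 1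
      have h3 : Tendsto (fun τ : ℂ ↦ lam (τ - 1)) l (𝓝 1) := by
        rw [sub_zero] at h2
        refine h2.congr' (him'.mono fun τ hτ ↦ ?_)
        rw [lam_S hτ]
        ring
      have h4 : Tendsto (fun τ : ℂ ↦ lam τ * (lam (τ - 1) - 1)) l (𝓝 (z * (1 - 1))) :=
        hz.mul (h3.sub_const 1)
      have h5 : Tendsto (fun τ : ℂ ↦ lam (τ - 1)) l (𝓝 (z * (1 - 1))) := by
        refine h4.congr' (him'.mono fun τ hτ ↦ ?_)
        have := lam_T hτ
        rwa [sub_add_cancel] at this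
      have := tendsto_nhds_unique h3 h5
      simp at this

/-! ### Image of the ideal triangle under `λ` -/

lemma exists_ultrafilter_of_mem_closure_image {f : ℂ → ℂ} {s : Set ℂ} {z : ℂ}
    (hz : z ∈ closure (f '' s)) :
    ∃ l : Ultrafilter ℂ, (∀ᶠ τ in l, τ ∈ s) ∧ Tendsto f l (𝓝 z) := by
  have hne : (𝓟 s ⊓ comap f (𝓝 z)).NeBot := by
    rw [← map_neBot_iff f, Filter.push_pull, map_principal, inf_comm]
    exact mem_closure_iff_clusterPt.mp hz
  refine ⟨Ultrafilter.of (𝓟 s ⊓ comap f (𝓝 z)), ?_, ?_⟩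
  · exact ((Ultrafilter.of_le _).trans inf_le_left) (mem_principal_self s)
  · exact tendsto_iff_comap.mpr ((Ultrafilter.of_le _).trans inf_le_right)

/-- Limits coming from the sides or the cusps are real. Thus the image is relatively closed off the
real axis, and, being open, contains every open half-plane that it meets. -/
lemma mem_image_lam_of_mem_closure {z : ℂ} (hz : z ∈ closure (lam '' idealTriangle))
    (him : z.im ≠ 0) : z ∈ lam '' idealTriangle := by
  obtain ⟨l, hl, hlim⟩ := exists_ultrafilter_of_mem_closure_image hz
  rcases lam_limit_idealTriangle hl hlim with ⟨-, h⟩ | h | ⟨τ, h0, h1, h2, h3, h⟩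
  · simp [h] at him
  · simp [h] at him
  · refine ⟨τ, ⟨h0, h1.lt_of_ne ?_, h2.lt_of_ne ?_, h3.lt_of_ne ?_⟩, h⟩
    · intro h'
      exact him (h ▸ lam_im_eq_zero_of_re_zero h'.symm)
    · intro h'
      exact him (h ▸ lam_im_eq_zero_of_re_one h')
    · intro h'
      exact him (h ▸ lam_im_eq_zero_of_circle h0 h')

/-- Open mapping theorem; `λ` is not constant because it tends to `0` at `i∞` without vanishing. -/
lemma isOpen_image_lam {s : Set ℂ} (hs : s ⊆ {τ | 0 < τ.im}) (ho : IsOpen s) :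
    IsOpen (lam '' s) := by
  have hU : IsOpen {τ : ℂ | 0 < τ.im} := isOpen_lt continuous_const continuous_im
  have han : AnalyticOnNhd ℂ lam {τ | 0 < τ.im} :=
    DifferentiableOn.analyticOnNhd
      (fun τ hτ ↦ (differentiableAt_lam hτ).differentiableWithinAt) hU
  rcases han.is_constant_or_isOpen (convex_halfSpace_im_gt 0).isPreconnected with ⟨w, hw⟩ | h
  · exfalso
    have h1 : Tendsto (fun n : ℝ ↦ lam (n * I)) atTop (𝓝 0) :=
      tendsto_lam.comp tendsto_mul_I_comap_im
    have h2 : Tendsto (fun n : ℝ ↦ lam (n * I)) atTop (𝓝 w) := by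
      refine tendsto_const_nhds.congr' ?_
      filter_upwards [eventually_gt_atTop 0] with n hn
      exact (hw _ (ofReal_mul_I_im_pos hn)).symm
    have h3 := hw (((1 : ℝ) : ℂ) * I) (ofReal_mul_I_im_pos one_pos)
    rw [tendsto_nhds_unique h2 h1] at h3
    exact lam_ne_zero (ofReal_mul_I_im_pos one_pos) h3
  · exact h s hs ho

/-- A single value in the lower half-plane would force all of it into the image. Then `0` would be a
limit of such values, necessarily at `i∞` since `λ` has no zeros, where the leading term `16q`
forbids them. -/
lemma lam_im_nonneg_of_mem_idealTriangle {τ : ℂ} (hτ : τ ∈ idealTriangle) : 0 ≤ (lam τ).im := by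
  by_contra! hneg
  have hopen := isOpen_image_lam (fun τ hτ ↦ hτ.1) isOpen_idealTriangle
  have hsub : {z : ℂ | z.im < 0} ⊆ lam '' idealTriangle :=
    (convex_halfSpace_im_lt 0).isPreconnected.subset_of_closure_inter_subset hopen
      ⟨lam τ, hneg, mem_image_of_mem _ hτ⟩
      fun z hz ↦ mem_image_lam_of_mem_closure hz.1 (ne_of_lt hz.2)
  have h0 : (0 : ℂ) ∈ closure (lam '' (idealTriangle ∩ {τ | (lam τ).im < 0})) := by
    have hsub' : {z : ℂ | z.im < 0} ⊆ lam '' (idealTriangle ∩ {τ | (lam τ).im < 0}) := by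
      intro z hz
      obtain ⟨τ, hτ, rfl⟩ := hsub hz
      exact ⟨τ, ⟨hτ, hz⟩, rfl⟩
    refine closure_mono hsub' ?_
    rw [closure_setOfPred_im_lt]
    simp
  obtain ⟨l, hl, hlim⟩ := exists_ultrafilter_of_mem_closure_image h0
  rcases lam_limit_idealTriangle (hl.mono fun τ hτ ↦ hτ.1) hlim with
    ⟨h, -⟩ | h | ⟨τ, h0, -, -, -, h⟩
  · have hev := eventually_lam_im_pos.filter_mono h
    obtain ⟨τ, h1, h2⟩ := (hl.and hev).exists
    exact lt_asymm h1.2 (h2 h1.1.2.1 h1.1.2.2.1)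
  · exact zero_ne_one h
  · exact lam_ne_zero h0 h

lemma lam_im_pos_of_mem_idealTriangle {τ : ℂ} (hτ : τ ∈ idealTriangle) : 0 < (lam τ).im := by
  refine (lam_im_nonneg_of_mem_idealTriangle hτ).lt_of_ne fun h ↦ ?_
  have hopen := isOpen_image_lam (fun τ hτ ↦ hτ.1) isOpen_idealTriangle
  obtain ⟨ε, hε, hball⟩ := Metric.isOpen_iff.mp hopen _ (mem_image_of_mem lam hτ)
  obtain ⟨σ, hσ, he⟩ := hball (show lam τ - (ε / 2 : ℝ) * I ∈ Metric.ball (lam τ) ε by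
    rw [mem_ball_iff_norm]
    simp [abs_of_pos hε, hε])
  have := lam_im_nonneg_of_mem_idealTriangle hσ
  rw [he] at this
  simp [← h] at this
  linarith

lemma exists_mem_idealTriangle {z : ℂ} (hz : 0 < z.im) : ∃ τ ∈ idealTriangle, lam τ = z := by
  have hopen := isOpen_image_lam (fun τ hτ ↦ hτ.1) isOpen_idealTriangle
  have hmem : (1 / 2 + 1 * I : ℂ) ∈ idealTriangle := by
    simp [idealTriangle, normSq_apply]
    norm_num
  exact (convex_halfSpace_im_gt 0).isPreconnected.subset_of_closure_inter_subset hopen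
    ⟨_, lam_im_pos_of_mem_idealTriangle hmem, mem_image_of_mem _ hmem⟩
    (fun z hz ↦ mem_image_lam_of_mem_closure hz.1 (ne_of_gt hz.2)) hz

lemma lam_mul_I {t : ℝ} (ht : 0 < t) : ∃ r : ℝ, 0 < r ∧ r < 1 ∧ lam (t * I) = r := by
  obtain ⟨a, ha, h2⟩ := theta2_mul_I ht
  obtain ⟨b, hb, h3⟩ := theta3_mul_I ht
  obtain ⟨c, hc, h4⟩ := theta4_mul_I ht
  have h := one_sub_lam (ofReal_mul_I_im_pos ht)
  rw [lam, h2, h3, h4] at h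
  have h' : 1 - (a / b) ^ 4 = (c / b) ^ 4 := by exact_mod_cast h
  refine ⟨(a / b) ^ 4, by positivity, ?_, ?_⟩
  · have : 0 < (c / b) ^ 4 := by positivity
    linarith
  · rw [lam, h2, h3]
    push_cast
    rfl

/-- Intermediate values between the limit `0` at `i∞` and the limit `1` at `0`, the latter from
`λ(i/t) = 1 - λ(it)`. -/
lemma exists_lam_mul_I {w : ℝ} (h0 : 0 < w) (h1 : w < 1) : ∃ t : ℝ, 0 < t ∧ lam (t * I) = w := by
  have hlim : Tendsto (fun t : ℝ ↦ (lam (t * I)).re) atTop (𝓝 0) := by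
    simpa [Function.comp_def] using
      (continuous_re.tendsto 0).comp (tendsto_lam.comp tendsto_mul_I_comap_im)
  obtain ⟨t₁, ht₁, hw₁⟩ :=
    ((eventually_gt_atTop 0).and (hlim.eventually (gt_mem_nhds h0))).exists
  obtain ⟨t₂, ht₂, hw₂⟩ :=
    ((eventually_gt_atTop 0).and (hlim.eventually (gt_mem_nhds (sub_pos.mpr h1)))).exists
  have hw₂' : w < (lam ((t₂⁻¹ : ℝ) * I)).re := by
    rw [← neg_one_div_mul_I, lam_S (ofReal_mul_I_im_pos ht₂), sub_re, one_re]
    linarith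
  have hcont : ContinuousOn (fun t : ℝ ↦ (lam (t * I)).re) (Ioi 0) := by
    intro t ht
    have h := (differentiableAt_lam (ofReal_mul_I_im_pos ht)).continuousAt
    have h' : ContinuousAt (fun t : ℝ ↦ (t * I : ℂ)) t := by fun_prop
    exact (continuous_re.continuousAt.comp
      (ContinuousAt.comp (f := fun t : ℝ ↦ (t * I : ℂ)) h h')).continuousWithinAt
  obtain ⟨t, ht, hw⟩ := isPreconnected_Ioi.intermediate_value (mem_Ioi.mpr ht₁)
    (mem_Ioi.mpr (inv_pos.mpr ht₂)) hcont ⟨hw₁.le, hw₂'.le⟩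
  refine ⟨t, ht, ?_⟩
  obtain ⟨r, -, -, hr⟩ := lam_mul_I ht
  simp only [hr, ofReal_re] at hw
  rw [hr, hw]

/-- The interior of the fundamental set. -/
def fundInterior : Set ℂ := {τ | 0 < τ.im ∧ |τ.re| < 1 ∧ |τ.re| < normSq τ}

/-- The plane without the rays `(-∞, 0]` and `[1, ∞)`. -/
def slitRegion : Set ℂ := {z | z.im ≠ 0 ∨ (0 < z.re ∧ z.re < 1)}

lemma neg_conj_mem_idealTriangle {τ : ℂ} (hτ : τ ∈ fundInterior) (h : τ.re < 0) :
    -conj τ ∈ idealTriangle := by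
  obtain ⟨h0, h1, h2⟩ := hτ
  rw [abs_of_neg h] at h1 h2
  exact ⟨by simpa using h0, by simpa using h, by simpa using h1, by simpa [normSq_neg] using h2⟩

lemma lam_mem_slitRegion {τ : ℂ} (hτ : τ ∈ fundInterior) : lam τ ∈ slitRegion := by
  rcases lt_trichotomy τ.re 0 with h | h | h
  · left
    have := lam_im_pos_of_mem_idealTriangle (neg_conj_mem_idealTriangle hτ h)
    rw [lam_conj, conj_im] at this
    linarith
  · right
    have e : τ = (τ.im : ℂ) * I := by apply Complex.ext <;> simp [h]
    obtain ⟨r, h0, h1, hr⟩ := lam_mul_I hτ.1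
    rw [e, hr]
    exact ⟨by simpa using h0, by simpa using h1⟩
  · left
    obtain ⟨h0, h1, h2⟩ := hτ
    rw [abs_of_pos h] at h1 h2
    exact (lam_im_pos_of_mem_idealTriangle ⟨h0, h, h1, h2⟩).ne'

lemma mul_I_mem_fundInterior {t : ℝ} (ht : 0 < t) : (t * I : ℂ) ∈ fundInterior := by
  simp [fundInterior, ht]

lemma mem_fundInterior_of_mem_idealTriangle {τ : ℂ} (hτ : τ ∈ idealTriangle) :
    τ ∈ fundInterior := by
  obtain ⟨h0, h, h1, h2⟩ := hτ
  exact ⟨h0, by rwa [abs_of_pos h], by rwa [abs_of_pos h]⟩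

lemma neg_conj_mem_fundInterior {τ : ℂ} (hτ : τ ∈ fundInterior) : -conj τ ∈ fundInterior := by
  obtain ⟨h0, h1, h2⟩ := hτ
  exact ⟨by simpa using h0, by simpa using h1, by simpa [normSq_neg] using h2⟩

/-- `λ` maps the interior of the fundamental set onto the slit region. -/
lemma exists_mem_fundInterior {z : ℂ} (hz : z ∈ slitRegion) : ∃ τ ∈ fundInterior, lam τ = z := by
  rcases lt_trichotomy z.im 0 with h | h | h
  · obtain ⟨τ, hτ, e⟩ := exists_mem_idealTriangle (z := conj z) (by simpa using h)
    refine ⟨-conj τ, neg_conj_mem_fundInterior (mem_fundInterior_of_mem_idealTriangle hτ), ?_⟩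
    rw [lam_conj, e, conj_conj]
  · rcases hz with hz | ⟨h0, h1⟩
    · exact absurd h hz
    · obtain ⟨t, ht, e⟩ := exists_lam_mul_I h0 h1
      refine ⟨_, mul_I_mem_fundInterior ht, ?_⟩
      rw [e]
      exact Complex.ext (by simp) (by simp [h])
  · obtain ⟨τ, hτ, e⟩ := exists_mem_idealTriangle h
    exact ⟨τ, mem_fundInterior_of_mem_idealTriangle hτ, e⟩

end

section

open Complex Filter Topology
open scoped Real ComplexConjugate

/-! ### Holomorphy of the elliptic integral and its relation to `λ` -/

open Set

lemma isClosed_cutRay : IsClosed cutRay :=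
  (isClosed_le continuous_const continuous_re).inter (isClosed_eq continuous_im continuous_const)

lemma one_sub_mul_mem_slitPlane {z : ℂ} (hz : z ∉ cutRay) {s : ℝ} (h0 : 0 ≤ s) (h1 : s ≤ 1) :
    1 - z * s ∈ slitPlane := by
  rw [mem_slitPlane_iff]
  rcases h0.eq_or_lt with rfl | h0
  · simp
  by_cases him : z.im = 0
  · left
    have hre : z.re < 1 := by
      by_contra! h
      exact hz ⟨h, him⟩
    simp only [sub_re, one_re, mul_re, ofReal_re, ofReal_im, mul_zero, sub_zero]
    nlinarith
  · right
    simp [him, h0.ne']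

/-- Differentiation under the integral sign; on a closed disc off the ray the differentiated
integrand is bounded by compactness. -/
lemma differentiableAt_ellipticIntegralK {z₀ : ℂ} (hz₀ : z₀ ∉ cutRay) :
    DifferentiableAt ℂ ellipticIntegralK z₀ := by
  obtain ⟨r, hr, hball⟩ := Metric.nhds_basis_closedBall.mem_iff.mp
    (isClosed_cutRay.isOpen_compl.mem_nhds hz₀)
  have hslit {z : ℂ} (hz : z ∈ Metric.closedBall z₀ r) (θ : ℝ) :
      1 - z * ((Real.sin θ ^ 2 : ℝ) : ℂ) ∈ slitPlane :=
    one_sub_mul_mem_slitPlane (hball hz) (sq_nonneg _) (Real.sin_sq_le_one θ)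
  have hcont (c : ℂ) : ContinuousOn
      (fun p : ℂ × ℝ ↦ (1 - p.1 * ((Real.sin p.2 ^ 2 : ℝ) : ℂ)) ^ c)
      (Metric.closedBall z₀ r ×ˢ univ) := by
    intro p hp
    refine ContinuousAt.continuousWithinAt ?_
    refine ContinuousAt.cpow ?_ continuousAt_const (hslit hp.1 _)
    fun_prop
  have hcont' (c : ℂ) {z : ℂ} (hz : z ∈ Metric.closedBall z₀ r) :
      Continuous fun θ : ℝ ↦ (1 - z * ((Real.sin θ ^ 2 : ℝ) : ℂ)) ^ c := by
    refine continuous_iff_continuousAt.mpr fun θ ↦ ?_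
    refine ContinuousAt.cpow ?_ continuousAt_const (hslit hz θ)
    fun_prop
  obtain ⟨C, hC⟩ := ((isCompact_closedBall z₀ r).prod
    (isCompact_Icc (a := (0 : ℝ)) (b := π / 2))).exists_bound_of_continuousOn
    ((hcont (-(1 / 2) - 1)).mono (prod_mono_right (subset_univ _)))
  have hpi : (0 : ℝ) ≤ π / 2 := by positivity
  have key := intervalIntegral.hasDerivAt_integral_of_dominated_loc_of_deriv_le
    (F := fun z θ ↦ (1 - z * ((Real.sin θ ^ 2 : ℝ) : ℂ)) ^ (-(1 / 2) : ℂ))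
    (F' := fun z θ ↦ -(1 / 2) * (1 - z * ((Real.sin θ ^ 2 : ℝ) : ℂ)) ^ (-(1 / 2) - 1 : ℂ) *
      (-((Real.sin θ ^ 2 : ℝ) : ℂ)))
    (bound := fun _ ↦ C) (μ := MeasureTheory.volume) (a := 0) (b := π / 2) (x₀ := z₀)
    (Metric.closedBall_mem_nhds z₀ hr) ?_ ?_ ?_ ?_ ?_ ?_
  · have h := key.2.differentiableAt
    have e : ellipticIntegralK = fun z ↦ ∫ θ in (0 : ℝ)..(π / 2),
        (1 - z * ((Real.sin θ ^ 2 : ℝ) : ℂ)) ^ (-(1 / 2) : ℂ) := by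
      funext z
      simp_rw [cpow_neg, ← one_div]
      rfl
    rw [e]
    exact h
  · filter_upwards [Metric.closedBall_mem_nhds z₀ hr] with z hz
    exact (hcont' _ hz).aestronglyMeasurable
  · exact (hcont' _ (Metric.mem_closedBall_self hr.le)).intervalIntegrable _ _
  · refine Continuous.aestronglyMeasurable ?_
    exact (continuous_const.mul (hcont' _ (Metric.mem_closedBall_self hr.le))).mul (by fun_prop)
  · refine Eventually.of_forall fun θ hθ z hz ↦ ?_
    rw [uIoc_of_le hpi] at hθ
    have h := hC (z, θ) ⟨hz, Ioc_subset_Icc_self hθ⟩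
    have hs : ‖-((Real.sin θ ^ 2 : ℝ) : ℂ)‖ ≤ 1 := by
      rw [norm_neg, norm_real, Real.norm_of_nonneg (sq_nonneg _)]
      exact Real.sin_sq_le_one θ
    have hhalf : ‖(-(1 / 2) : ℂ)‖ ≤ 1 := by norm_num
    rw [norm_mul, norm_mul]
    have h0 := norm_nonneg ((1 - z * ((Real.sin θ ^ 2 : ℝ) : ℂ)) ^ (-(1 / 2) - 1 : ℂ))
    calc _ ≤ 1 * ‖(1 - z * ((Real.sin θ ^ 2 : ℝ) : ℂ)) ^ (-(1 / 2) - 1 : ℂ)‖ * 1 := by gcongr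
      _ ≤ C := by simpa using h
  · simp
  · refine Eventually.of_forall fun θ hθ z hz ↦ ?_
    refine HasDerivAt.cpow_const ?_ (hslit hz θ)
    simpa only [one_mul] using
      ((hasDerivAt_id' z).mul_const ((Real.sin θ ^ 2 : ℝ) : ℂ)).const_sub 1

lemma slitRegion_notMem_cutRay {z : ℂ} (hz : z ∈ slitRegion) : z ∉ cutRay := by
  rintro ⟨h1, h2⟩
  rcases hz with h | ⟨-, h⟩
  · exact h h2
  · linarith

lemma one_sub_mem_slitRegion {z : ℂ} (hz : z ∈ slitRegion) : 1 - z ∈ slitRegion := by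
  rcases hz with h | ⟨h0, h1⟩
  · left
    simpa using h
  · right
    simp only [sub_re, one_re]
    constructor <;> linarith

lemma isOpen_fundInterior : IsOpen fundInterior :=
  (isOpen_lt continuous_const continuous_im).inter
    ((isOpen_lt continuous_re.abs continuous_const).inter
      (isOpen_lt continuous_re.abs continuous_normSq))

/-- The region lies above the graph of `√(|x| - x²)` over `(-1, 1)`, so a vertical shift makes it a
continuous image of a convex half-strip. -/
lemma isPreconnected_fundInterior : IsPreconnected fundInterior := by
  have hcv : Convex ℝ (Ioo (-1 : ℝ) 1 ×ˢ Ioi (0 : ℝ)) := (convex_Ioo _ _).prod (convex_Ioi _)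
  have himg : (fun p : ℝ × ℝ ↦ (p.1 : ℂ) + (√(|p.1| - p.1 ^ 2) + p.2 : ℝ) * I) ''
      (Ioo (-1 : ℝ) 1 ×ˢ Ioi (0 : ℝ)) = fundInterior := by
    ext τ
    constructor
    · rintro ⟨⟨x, s⟩, ⟨hx, hs⟩, rfl⟩
      have hx : |x| < 1 := abs_lt.mpr hx
      have hs : 0 < s := hs
      have h0 := Real.sqrt_nonneg (|x| - x ^ 2)
      have hnn : 0 ≤ |x| - x ^ 2 := by
        rw [← sq_abs]
        nlinarith [abs_nonneg x]
      have hsq := Real.sq_sqrt hnn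
      refine ⟨?_, ?_, ?_⟩
      · simp
        positivity
      · simpa using hx
      · simp [normSq_apply]
        nlinarith
    · rintro ⟨h0, h1, h2⟩
      refine ⟨(τ.re, τ.im - √(|τ.re| - τ.re ^ 2)), ⟨abs_lt.mp h1, ?_⟩, ?_⟩
      · rw [normSq_apply] at h2
        simp only [mem_Ioi, sub_pos]
        rw [Real.sqrt_lt' h0]
        linarith
      · apply Complex.ext <;> simp
  rw [← himg]
  refine hcv.isPreconnected.image _ (Continuous.continuousOn ?_)
  fun_prop

lemma frequently_mul_I : ∃ᶠ τ in 𝓝[≠] I, ∃ t : ℝ, 0 < t ∧ τ = t * I := by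
  have h : Tendsto (fun t : ℝ ↦ (t * I : ℂ)) (𝓝[≠] 1) (𝓝[≠] I) := by
    refine tendsto_nhdsWithin_iff.mpr ⟨?_, ?_⟩
    · have : Continuous fun t : ℝ ↦ (t * I : ℂ) := by fun_prop
      simpa using (this.tendsto 1).mono_left nhdsWithin_le_nhds
    · filter_upwards [self_mem_nhdsWithin] with t ht h
      refine ht ?_
      have := congrArg Complex.im (h : (t * I : ℂ) = I)
      simpa using this
  refine h.frequently (Eventually.frequently ?_)
  filter_upwards [nhdsWithin_le_nhds (lt_mem_nhds one_pos)] with t ht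
  exact ⟨t, ht, rfl⟩

lemma eqOn_fundInterior {f g : ℂ → ℂ} (hf : DifferentiableOn ℂ f fundInterior)
    (hg : DifferentiableOn ℂ g fundInterior) (h : ∀ t : ℝ, 0 < t → f (t * I) = g (t * I)) :
    EqOn f g fundInterior := by
  have hI : I ∈ fundInterior := by simpa using mul_I_mem_fundInterior one_pos
  refine (hf.analyticOnNhd isOpen_fundInterior).eqOn_of_preconnected_of_frequently_eq
    (hg.analyticOnNhd isOpen_fundInterior) isPreconnected_fundInterior hI ?_
  refine frequently_mul_I.mono ?_
  rintro τ ⟨t, ht, rfl⟩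
  exact h t ht

/-- Jacobi's formula `K(λ(τ)) = (π / 2) θ₃(τ)²`. -/
lemma ellipticIntegralK_lam {τ : ℂ} (hτ : τ ∈ fundInterior) :
    ellipticIntegralK (lam τ) = π / 2 * theta3 τ ^ 2 := by
  refine eqOn_fundInterior (f := fun τ ↦ ellipticIntegralK (lam τ))
    (g := fun τ ↦ π / 2 * theta3 τ ^ 2) (fun τ hτ ↦ ?_) (fun τ hτ ↦ ?_)
    (fun t ht ↦ ellipticIntegralK_lam_mul_I ht) hτ
  · exact (DifferentiableAt.comp τ (differentiableAt_ellipticIntegralK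
      (slitRegion_notMem_cutRay (lam_mem_slitRegion hτ)))
      (differentiableAt_lam hτ.1)).differentiableWithinAt
  · exact (((differentiableAt_theta3 hτ.1).pow 2).const_mul _).differentiableWithinAt

lemma neg_one_div_mem_fundInterior {τ : ℂ} (hτ : τ ∈ fundInterior) : -1 / τ ∈ fundInterior := by
  obtain ⟨h0, h1, h2⟩ := hτ
  have hn := normSq_pos_of_im_pos h0
  refine ⟨neg_one_div_im_pos h0, ?_, ?_⟩
  · rw [neg_one_div_re, abs_div, abs_neg, abs_of_pos hn, div_lt_one hn]
    exact h2
  · rw [neg_one_div_re, abs_div, abs_neg, abs_of_pos hn, normSq_div, normSq_neg, normSq_one]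
    gcongr

lemma ellipticIntegralK_one_sub_lam {τ : ℂ} (hτ : τ ∈ fundInterior) :
    ellipticIntegralK (1 - lam τ) = -I * τ * (π / 2 * theta3 τ ^ 2) := by
  have h0 : τ ≠ 0 := by
    rintro rfl
    simpa using hτ.1
  rw [← lam_S hτ.1, ellipticIntegralK_lam (neg_one_div_mem_fundInterior hτ), theta3_S h0, mul_pow,
    neg_I_mul_cpow_sq]
  ring

lemma ellipticIntegralK_lam_ne_zero {τ : ℂ} (hτ : τ ∈ fundInterior) :
    ellipticIntegralK (lam τ) ≠ 0 := by
  rw [ellipticIntegralK_lam hτ]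
  refine mul_ne_zero ?_ (pow_ne_zero _ (theta3_ne_zero hτ.1))
  simp [Real.pi_ne_zero]

/-- On the interior of the fundamental set, `λ` is characterized by elliptic integrals. -/
lemma lam_eq_iff {τ z : ℂ} (hτ : τ ∈ fundInterior) :
    lam τ = z ↔ z ∈ slitRegion ∧ ellipticIntegralK z * τ = I * ellipticIntegralK (1 - z) := by
  constructor
  · rintro rfl
    refine ⟨lam_mem_slitRegion hτ, ?_⟩
    rw [ellipticIntegralK_lam hτ, ellipticIntegralK_one_sub_lam hτ]
    linear_combination (τ * (π / 2 * theta3 τ ^ 2)) * I_sq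
  · rintro ⟨hz, h⟩
    -- Both `σ` and `τ` solve the same linear equation with nonzero coefficient `K(z)`.
    obtain ⟨σ, hσ, rfl⟩ := exists_mem_fundInterior hz
    have h0 := ellipticIntegralK_lam_ne_zero hσ
    have h' : ellipticIntegralK (lam σ) * σ = I * ellipticIntegralK (1 - lam σ) := by
      rw [ellipticIntegralK_lam hσ, ellipticIntegralK_one_sub_lam hσ]
      linear_combination (σ * (π / 2 * theta3 σ ^ 2)) * I_sq
    rw [mul_left_cancel₀ h0 (h.trans h'.symm)]

end

section

open Complex Filter Topology
open scoped Real ComplexConjugate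

/-! ### Quantifier-free and strongly definable predicates of `R_K` -/

open FirstOrder Language

/-- A real function of the variables in `α` given by a term of the language of `R_K`. -/
def IsTermFun {α : Type} (f : (α → ℝ) → ℝ) : Prop :=
  ∃ t : RKLang.Term α, ∀ a, t.realize a = f a

/-- A predicate defined by a quantifier-free formula of the language of `R_K`. -/
def IsQFPred {α : Type} (P : (α → ℝ) → Prop) : Prop :=
  ∃ φ : RKLang.Formula α, φ.IsQF ∧ ∀ a, φ.Realize a ↔ P a

/-- A predicate defined by an existential formula with unique witnesses. -/
def IsSDPred {α : Type} (P : (α → ℝ) → Prop) : Prop :=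
  ∃ (m : ℕ) (Q : (α ⊕ Fin m → ℝ) → Prop), IsQFPred Q ∧
    (∀ a, P a ↔ ∃ b, Q (Sum.elim a b)) ∧
    ∀ a b b', Q (Sum.elim a b) → Q (Sum.elim a b') → b = b'

section Terms

variable {α β : Type} {f g : (α → ℝ) → ℝ}

lemma isTermFun_var (i : α) : IsTermFun fun a : α → ℝ ↦ a i := ⟨Term.var i, fun _ ↦ rfl⟩

lemma isTermFun_const (r : ℝ) : IsTermFun fun _ : α → ℝ ↦ r :=
  ⟨Term.func (L := RKLang) (l := 0) (RKFunc.const r) Fin.elim0, fun _ ↦ rfl⟩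

lemma IsTermFun.add (hf : IsTermFun f) (hg : IsTermFun g) : IsTermFun fun a ↦ f a + g a := by
  obtain ⟨s, hs⟩ := hf
  obtain ⟨t, ht⟩ := hg
  refine ⟨Term.func (L := RKLang) (l := 2) RKFunc.add ![s, t], fun a ↦ ?_⟩
  change s.realize a + t.realize a = _
  rw [hs, ht]

lemma IsTermFun.mul (hf : IsTermFun f) (hg : IsTermFun g) : IsTermFun fun a ↦ f a * g a := by
  obtain ⟨s, hs⟩ := hf
  obtain ⟨t, ht⟩ := hg
  refine ⟨Term.func (L := RKLang) (l := 2) RKFunc.mul ![s, t], fun a ↦ ?_⟩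
  change s.realize a * t.realize a = _
  rw [hs, ht]

lemma IsTermFun.neg (hf : IsTermFun f) : IsTermFun fun a ↦ -f a := by
  obtain ⟨s, hs⟩ := hf
  refine ⟨Term.func (L := RKLang) (l := 1) RKFunc.neg ![s], fun a ↦ ?_⟩
  change -s.realize a = _
  rw [hs]

lemma IsTermFun.sub (hf : IsTermFun f) (hg : IsTermFun g) : IsTermFun fun a ↦ f a - g a := by
  simpa only [sub_eq_add_neg] using hf.add hg.neg

lemma IsTermFun.exp (hf : IsTermFun f) : IsTermFun fun a ↦ Real.exp (f a) := by
  obtain ⟨s, hs⟩ := hf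
  refine ⟨Term.func (L := RKLang) (l := 1) RKFunc.exp ![s], fun a ↦ ?_⟩
  change Real.exp (s.realize a) = _
  rw [hs]

lemma IsTermFun.comp (hf : IsTermFun f) (e : α → β) : IsTermFun fun b : β → ℝ ↦ f (b ∘ e) := by
  obtain ⟨s, hs⟩ := hf
  exact ⟨s.relabel e, fun a ↦ by rw [Term.realize_relabel, hs]⟩

/-- A complex function whose real and imaginary parts are given by terms. -/
def IsComplexTermFun (F : (α → ℝ) → ℂ) : Prop :=
  IsTermFun (fun a ↦ (F a).re) ∧ IsTermFun (fun a ↦ (F a).im)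

variable {F G : (α → ℝ) → ℂ}

lemma isComplexTermFun_const (c : ℂ) : IsComplexTermFun fun _ : α → ℝ ↦ c :=
  ⟨isTermFun_const _, isTermFun_const _⟩

lemma isComplexTermFun_mk (hf : IsTermFun f) (hg : IsTermFun g) :
    IsComplexTermFun fun a ↦ (⟨f a, g a⟩ : ℂ) := ⟨hf, hg⟩

lemma IsComplexTermFun.add (hF : IsComplexTermFun F) (hG : IsComplexTermFun G) :
    IsComplexTermFun fun a ↦ F a + G a :=
  ⟨by simpa only [add_re] using hF.1.add hG.1, by simpa only [add_im] using hF.2.add hG.2⟩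

lemma IsComplexTermFun.sub (hF : IsComplexTermFun F) (hG : IsComplexTermFun G) :
    IsComplexTermFun fun a ↦ F a - G a :=
  ⟨by simpa only [sub_re] using hF.1.sub hG.1, by simpa only [sub_im] using hF.2.sub hG.2⟩

lemma IsComplexTermFun.mul (hF : IsComplexTermFun F) (hG : IsComplexTermFun G) :
    IsComplexTermFun fun a ↦ F a * G a :=
  ⟨by simpa only [mul_re] using (hF.1.mul hG.1).sub (hF.2.mul hG.2),
    by simpa only [mul_im] using (hF.1.mul hG.2).add (hF.2.mul hG.1)⟩

lemma IsComplexTermFun.pow (hF : IsComplexTermFun F) (n : ℕ) :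
    IsComplexTermFun fun a ↦ F a ^ n := by
  induction n with
  | zero => simpa only [pow_zero] using isComplexTermFun_const 1
  | succ n ih => simpa only [pow_succ] using ih.mul hF

lemma IsComplexTermFun.comp (hF : IsComplexTermFun F) (e : α → β) :
    IsComplexTermFun fun b : β → ℝ ↦ F (b ∘ e) := ⟨hF.1.comp e, hF.2.comp e⟩

lemma IsComplexTermFun.ellipticK (hF : IsComplexTermFun F) :
    IsComplexTermFun fun a ↦ ellipticK (F a) := by
  obtain ⟨⟨s, hs⟩, t, ht⟩ := hF
  refine ⟨⟨Term.func (L := RKLang) (l := 2) RKFunc.reK ![s, t], fun a ↦ ?_⟩,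
    ⟨Term.func (L := RKLang) (l := 2) RKFunc.imK ![s, t], fun a ↦ ?_⟩⟩
  · change (_root_.ellipticK ⟨s.realize a, t.realize a⟩).re = _
    rw [hs, ht]
  · change (_root_.ellipticK ⟨s.realize a, t.realize a⟩).im = _
    rw [hs, ht]

lemma IsTermFun.normSq (hF : IsComplexTermFun F) : IsTermFun fun a ↦ Complex.normSq (F a) := by
  simpa only [normSq_apply] using (hF.1.mul hF.1).add (hF.2.mul hF.2)

end Terms

section QuantifierFree

variable {α β : Type} {P Q : (α → ℝ) → Prop} {f g : (α → ℝ) → ℝ} {F G : (α → ℝ) → ℂ}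

lemma IsTermFun.eq (hf : IsTermFun f) (hg : IsTermFun g) : IsQFPred fun a ↦ f a = g a := by
  obtain ⟨s, hs⟩ := hf
  obtain ⟨t, ht⟩ := hg
  refine ⟨s.equal t, (BoundedFormula.IsAtomic.equal _ _).isQF, fun a ↦ ?_⟩
  rw [Formula.realize_equal, hs, ht]

lemma IsQFPred.and (hP : IsQFPred P) (hQ : IsQFPred Q) : IsQFPred fun a ↦ P a ∧ Q a := by
  obtain ⟨φ, hφ, h⟩ := hP
  obtain ⟨ψ, hψ, h'⟩ := hQ
  exact ⟨φ ⊓ ψ, hφ.inf hψ, fun a ↦ by rw [Formula.realize_inf, h, h']⟩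

lemma IsQFPred.or (hP : IsQFPred P) (hQ : IsQFPred Q) : IsQFPred fun a ↦ P a ∨ Q a := by
  obtain ⟨φ, hφ, h⟩ := hP
  obtain ⟨ψ, hψ, h'⟩ := hQ
  exact ⟨φ ⊔ ψ, hφ.sup hψ, fun a ↦ by rw [Formula.realize_sup, h, h']⟩

lemma IsQFPred.not (hP : IsQFPred P) : IsQFPred fun a ↦ ¬P a := by
  obtain ⟨φ, hφ, h⟩ := hP
  exact ⟨φ.not, hφ.not, fun a ↦ by rw [Formula.realize_not, h]⟩

lemma IsQFPred.comp (hP : IsQFPred P) (e : α → β) : IsQFPred fun b : β → ℝ ↦ P (b ∘ e) := by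
  obtain ⟨φ, hφ, h⟩ := hP
  exact ⟨φ.relabel e, hφ.relabel _, fun b ↦ by rw [Formula.realize_relabel, h]⟩

lemma IsComplexTermFun.eq (hF : IsComplexTermFun F) (hG : IsComplexTermFun G) :
    IsQFPred fun a ↦ F a = G a := by
  simpa only [Complex.ext_iff] using (hF.1.eq hG.1).and (hF.2.eq hG.2)

lemma isQFPred_forall_eq_zero {ι : Type} [Finite ι] (e : ι → α) :
    IsQFPred fun a : α → ℝ ↦ ∀ i, a (e i) = 0 := by
  classical
  cases nonempty_fintype ι
  have h (s : Finset ι) : IsQFPred fun a : α → ℝ ↦ ∀ i ∈ s, a (e i) = 0 := by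
    induction s using Finset.induction_on with
    -- The empty conjunction is realized by the equation `0 = 0`.
    | empty => simpa using (isTermFun_const (α := α) 0).eq (isTermFun_const 0)
    | insert i s _ ih =>
      simpa only [Finset.forall_mem_insert] using
        ((isTermFun_var (e i)).eq (isTermFun_const 0)).and ih
  simpa using h Finset.univ

end QuantifierFree

section StronglyDefinable

variable {α : Type} {P Q : (α → ℝ) → Prop} {f g : (α → ℝ) → ℝ}

lemma stronglyDefinable_of_isSDPred {n : ℕ} {X : Set (Fin n → ℝ)} (h : IsSDPred fun a ↦ a ∈ X) :
    StronglyDefinable RKLang X := by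
  obtain ⟨m, Q, ⟨φ, hφ, hQ⟩, hX, hu⟩ := h
  refine ⟨m, φ, hφ, fun a ↦ ?_, fun a ha ↦ ?_⟩
  · simp only [hQ]
    exact hX a
  · obtain ⟨b, hb⟩ := (hX a).mp ha
    simp only [hQ]
    exact ⟨b, hb, fun b' hb' ↦ hu a b' b hb' hb⟩

/-- Witnesses may be indexed by any finite type. -/
lemma isSDPred_of_witness {ι : Type} [Finite ι] {Q : (α ⊕ ι → ℝ) → Prop} (hQ : IsQFPred Q)
    (hP : ∀ a, P a ↔ ∃ b, Q (Sum.elim a b))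
    (hu : ∀ a b b', Q (Sum.elim a b) → Q (Sum.elim a b') → b = b') : IsSDPred P := by
  obtain ⟨m, ⟨e⟩⟩ := Finite.exists_equiv_fin ι
  have hcomp (a : α → ℝ) (b : Fin m → ℝ) :
      Sum.elim a b ∘ Sum.map id e = Sum.elim a (b ∘ e) := by
    rw [Sum.elim_comp_map, Function.comp_id]
  refine ⟨m, fun v ↦ Q (v ∘ Sum.map id e), hQ.comp _, fun a ↦ ?_, fun a b b' h h' ↦ ?_⟩
  · rw [hP]
    simp only [hcomp]
    constructor
    · rintro ⟨b, hb⟩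
      exact ⟨b ∘ e.symm, by simpa [Function.comp_assoc] using hb⟩
    · rintro ⟨b, hb⟩
      exact ⟨_, hb⟩
  · simp only [hcomp] at h h'
    have := hu _ _ _ h h'
    exact e.surjective.injective_comp_right this

lemma IsQFPred.isSDPred (hP : IsQFPred P) : IsSDPred P := by
  refine isSDPred_of_witness (ι := Empty) (hP.comp Sum.inl) (fun a ↦ ?_)
    fun a b b' _ _ ↦ Subsingleton.elim _ _
  simp only [Sum.elim_comp_inl]
  exact ⟨fun h ↦ ⟨Empty.elim, h⟩, fun ⟨_, h⟩ ↦ h⟩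

/-- There is no order symbol: positivity of `x` means `exp y = x` for some `y`, and `y = log x` is
the only such witness. -/
lemma IsTermFun.pos (hf : IsTermFun f) : IsSDPred fun a ↦ 0 < f a := by
  refine isSDPred_of_witness (ι := Unit)
    ((isTermFun_var (Sum.inr ())).exp.eq (hf.comp Sum.inl)) (fun a ↦ ?_) fun a b b' h h' ↦ ?_
  · simp only [Sum.elim_comp_inl, Sum.elim_inr]
    constructor
    · intro h
      exact ⟨fun _ ↦ Real.log (f a), Real.exp_log h⟩
    · rintro ⟨b, hb⟩
      rw [← hb]
      exact Real.exp_pos _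
  · simp only [Sum.elim_comp_inl, Sum.elim_inr] at h h'
    funext i
    exact Real.exp_injective (h.trans h'.symm)

lemma IsTermFun.lt (hf : IsTermFun f) (hg : IsTermFun g) : IsSDPred fun a ↦ f a < g a := by
  simpa only [sub_pos] using (hg.sub hf).pos

lemma IsSDPred.and (hP : IsSDPred P) (hQ : IsSDPred Q) : IsSDPred fun a ↦ P a ∧ Q a := by
  obtain ⟨m, P', hP', hPe, hPu⟩ := hP
  obtain ⟨n, Q', hQ', hQe, hQu⟩ := hQ
  have e₁ (a : α → ℝ) (b : Fin m ⊕ Fin n → ℝ) :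
      Sum.elim a b ∘ Sum.map id Sum.inl = Sum.elim a (b ∘ Sum.inl) := by
    rw [Sum.elim_comp_map, Function.comp_id]
  have e₂ (a : α → ℝ) (b : Fin m ⊕ Fin n → ℝ) :
      Sum.elim a b ∘ Sum.map id Sum.inr = Sum.elim a (b ∘ Sum.inr) := by
    rw [Sum.elim_comp_map, Function.comp_id]
  refine isSDPred_of_witness (ι := Fin m ⊕ Fin n)
    ((hP'.comp (Sum.map id Sum.inl)).and (hQ'.comp (Sum.map id Sum.inr))) (fun a ↦ ?_)
    fun a b b' h h' ↦ ?_
  · simp only [e₁, e₂, hPe, hQe]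
    constructor
    · rintro ⟨⟨b, hb⟩, c, hc⟩
      exact ⟨Sum.elim b c, by simpa using ⟨hb, hc⟩⟩
    · rintro ⟨b, hb, hc⟩
      exact ⟨⟨_, hb⟩, _, hc⟩
  · simp only [e₁, e₂] at h h'
    rw [← Sum.elim_comp_inl_inr b, ← Sum.elim_comp_inl_inr b', hPu _ _ _ h.1 h'.1,
      hQu _ _ _ h.2 h'.2]

/-- The witness block of the inactive alternative is set to zero. Disjointness ensures that only one
alternative supplies witnesses. -/
lemma IsSDPred.or (hP : IsSDPred P) (hQ : IsSDPred Q) (hd : ∀ a, P a → ¬Q a) :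
    IsSDPred fun a ↦ P a ∨ Q a := by
  obtain ⟨m, P', hP', hPe, hPu⟩ := hP
  obtain ⟨n, Q', hQ', hQe, hQu⟩ := hQ
  have e₁ (a : α → ℝ) (b : Fin m ⊕ Fin n → ℝ) :
      Sum.elim a b ∘ Sum.map id Sum.inl = Sum.elim a (b ∘ Sum.inl) := by
    rw [Sum.elim_comp_map, Function.comp_id]
  have e₂ (a : α → ℝ) (b : Fin m ⊕ Fin n → ℝ) :
      Sum.elim a b ∘ Sum.map id Sum.inr = Sum.elim a (b ∘ Sum.inr) := by
    rw [Sum.elim_comp_map, Function.comp_id]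
  refine isSDPred_of_witness (ι := Fin m ⊕ Fin n)
    (((hP'.comp (Sum.map id Sum.inl)).and
      (isQFPred_forall_eq_zero fun j : Fin n ↦ Sum.inr (Sum.inr j))).or
    ((hQ'.comp (Sum.map id Sum.inr)).and
      (isQFPred_forall_eq_zero fun j : Fin m ↦ Sum.inr (Sum.inl j)))) (fun a ↦ ?_)
    fun a b b' h h' ↦ ?_
  · simp only [e₁, e₂, hPe, hQe, Sum.elim_inr]
    constructor
    · rintro (⟨b, hb⟩ | ⟨c, hc⟩)
      · exact ⟨Sum.elim b 0, Or.inl (by simpa using hb)⟩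
      · exact ⟨Sum.elim 0 c, Or.inr (by simpa using hc)⟩
    · rintro ⟨b, hb | hb⟩
      · exact Or.inl ⟨_, hb.1⟩
      · exact Or.inr ⟨_, hb.1⟩
  · simp only [e₁, e₂, Sum.elim_inr] at h h'
    rcases h with ⟨h, h0⟩ | ⟨h, h0⟩ <;> rcases h' with ⟨h', h0'⟩ | ⟨h', h0'⟩
    · have := hPu _ _ _ h h'
      funext i
      rcases i with i | i
      · exact congrFun this i
      · rw [h0, h0']
    · exact absurd ((hQe a).mpr ⟨_, h'⟩) (hd a ((hPe a).mpr ⟨_, h⟩))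
    · exact absurd ((hQe a).mpr ⟨_, h⟩) (hd a ((hPe a).mpr ⟨_, h'⟩))
    · have := hQu _ _ _ h h'
      funext i
      rcases i with i | i
      · rw [h0, h0']
      · exact congrFun this i

/-- Projection along a coordinate projection with at most one point in each fibre. -/
lemma IsSDPred.exists {ι : Type} [Finite ι] {R : (α ⊕ ι → ℝ) → Prop} (hR : IsSDPred R)
    (hP : ∀ a, P a ↔ ∃ b, R (Sum.elim a b))
    (hu : ∀ a b b', R (Sum.elim a b) → R (Sum.elim a b') → b = b') : IsSDPred P := by
  obtain ⟨m, R', hR', hRe, hRu⟩ := hR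
  have e (a : α → ℝ) (b : ι ⊕ Fin m → ℝ) : Sum.elim a b ∘ Equiv.sumAssoc α ι (Fin m) =
      Sum.elim (Sum.elim a (b ∘ Sum.inl)) (b ∘ Sum.inr) := by
    funext i
    rcases i with (i | i) | i <;> rfl
  refine isSDPred_of_witness (ι := ι ⊕ Fin m) (hR'.comp (Equiv.sumAssoc α ι (Fin m)))
    (fun a ↦ ?_) fun a b b' h h' ↦ ?_
  · simp only [e, hP, hRe]
    constructor
    · rintro ⟨b, c, h⟩
      exact ⟨Sum.elim b c, by simpa using h⟩
    · rintro ⟨b, h⟩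
      exact ⟨_, _, h⟩
  · simp only [e] at h h'
    have h1 := hu _ _ _ ((hRe _).mpr ⟨_, h⟩) ((hRe _).mpr ⟨_, h'⟩)
    rw [← h1] at h'
    rw [← Sum.elim_comp_inl_inr b, ← Sum.elim_comp_inl_inr b', hRu _ _ _ h h', h1]

/-- Projection along a complex coordinate with at most one point in each fibre. -/
lemma IsSDPred.exists_complex {R : (α → ℝ) → ℂ → Prop}
    (hR : IsSDPred fun v : α ⊕ Fin 2 → ℝ ↦ R (v ∘ Sum.inl) ⟨v (Sum.inr 0), v (Sum.inr 1)⟩)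
    (hu : ∀ a w w', R a w → R a w' → w = w') : IsSDPred fun a ↦ ∃ w, R a w := by
  refine hR.exists (fun a ↦ ?_) fun a b b' h h' ↦ ?_
  · simp only [Sum.elim_comp_inl, Sum.elim_inr]
    constructor
    · rintro ⟨w, hw⟩
      exact ⟨![w.re, w.im], hw⟩
    · rintro ⟨b, hb⟩
      exact ⟨_, hb⟩
  · simp only [Sum.elim_comp_inl, Sum.elim_inr] at h h'
    have := hu _ _ _ h h'
    rw [Complex.ext_iff] at this
    funext i
    fin_cases i
    · exact this.1
    · exact this.2

end StronglyDefinable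

end

section

open Complex Filter Topology
open scoped Real ComplexConjugate

/-! ### Strong definability of `λ` and `j` -/

lemma ellipticK_of_mem_slitRegion {z : ℂ} (hz : z ∈ slitRegion) :
    ellipticK z = ellipticIntegralK z := if_neg (slitRegion_notMem_cutRay hz)

lemma lam_eq_iff_ellipticK {τ z : ℂ} (hτ : τ ∈ fundInterior) :
    lam τ = z ↔ z ∈ slitRegion ∧ ellipticK z * τ = I * ellipticK (1 - z) := by
  rw [lam_eq_iff hτ]
  refine and_congr_right fun hz ↦ ?_
  rw [ellipticK_of_mem_slitRegion hz, ellipticK_of_mem_slitRegion (one_sub_mem_slitRegion hz)]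

/-- The fundamental set as a subset of `ℂ`. -/
def fundRegion : Set ℂ := {τ | 0 < τ.im ∧ |τ.re| ≤ 1 ∧ |τ.re| ≤ normSq τ}

/-- Expand `|2τ ± 1|² = 4|τ|² ± 4 Re τ + 1`. -/
lemma mem_fundSet_iff (τ : ℍ) : τ ∈ fundSet ↔ (τ : ℂ) ∈ fundRegion := by
  have h1 : (1 ≤ ‖2 * (τ : ℂ) + 1‖) ↔ -τ.re ≤ normSq τ := by
    rw [← one_le_sq_iff₀ (norm_nonneg _), ← normSq_eq_norm_sq, normSq_apply, normSq_apply]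
    simp
    constructor <;> intro h <;> nlinarith
  have h2 : (1 ≤ ‖2 * (τ : ℂ) - 1‖) ↔ τ.re ≤ normSq τ := by
    rw [← one_le_sq_iff₀ (norm_nonneg _), ← normSq_eq_norm_sq, normSq_apply, normSq_apply]
    simp
    constructor <;> intro h <;> nlinarith
  simp only [fundSet, fundRegion, Set.mem_ofPred_eq, h1, h2, UpperHalfPlane.coe_re,
    UpperHalfPlane.coe_im, τ.im_pos, true_and, abs_le']
  tauto

lemma lam_ne_one {τ : ℂ} (hτ : 0 < τ.im) : lam τ - 1 ≠ 0 := by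
  have := one_sub_lam_ne_zero hτ
  contrapose! this
  linear_combination -this

lemma normSq_eq_add (τ : ℂ) : normSq τ = τ.re ^ 2 + τ.im ^ 2 := by
  rw [normSq_apply]
  ring

lemma mem_fundInterior_of_re_eq_zero {σ : ℂ} (h0 : 0 < σ.im) (h : σ.re = 0) :
    σ ∈ fundInterior := by
  refine ⟨h0, ?_, ?_⟩ <;> rw [h, abs_zero]
  · exact one_pos
  · exact normSq_pos_of_im_pos h0

/-- The piece of the graph of `λ` over the interior. -/
def graphInterior (τ z : ℂ) : Prop := τ ∈ fundInterior ∧ lam τ = z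

/-- The pieces of the graph of `λ` over the vertical sides; `ε = ± 1`. -/
def graphSide (ε : ℝ) (τ z : ℂ) : Prop :=
  (τ.re = ε ∧ 0 < τ.im) ∧ ∃ w, graphInterior (τ - ε) w ∧ w * (z - 1) = z

/-- The pieces of the graph of `λ` over the circular sides; `ε = ± 1`. -/
def graphCircle (ε : ℝ) (τ z : ℂ) : Prop :=
  (normSq τ = ε * τ.re ∧ 0 < τ.im) ∧
    ∃ σ, σ * τ = ε * τ - 1 ∧ ∃ w, graphInterior σ w ∧ (1 - w) * z = 1

/-- Translation by `ε` leads to the imaginary axis, inside the interior. The relation `λ(τ) λ(τ + 1)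
= λ(τ) + λ(τ + 1)` is symmetric, so one equation serves both signs. -/
lemma graphSide_iff {ε : ℝ} (hε : ε = 1 ∨ ε = -1) {τ z : ℂ} :
    graphSide ε τ z ↔ (τ.re = ε ∧ 0 < τ.im) ∧ lam τ = z := by
  refine and_congr_right fun ⟨hre, him⟩ ↦ ?_
  have him' : 0 < (τ - ε).im := by simpa using him
  have hint : τ - ε ∈ fundInterior := mem_fundInterior_of_re_eq_zero him' (by simp [hre])
  have key : lam (τ - ε) * (lam τ - 1) = lam τ := by
    rcases hε with rfl | rfl
    · have := lam_T him'
      rw [ofReal_one, sub_add_cancel] at this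
      rw [ofReal_one]
      linear_combination this
    · have := lam_T him
      push_cast
      rwa [sub_neg_eq_add]
  constructor
  · rintro ⟨w, ⟨-, rfl⟩, h⟩
    have h1 := lam_ne_one him'
    refine mul_left_cancel₀ h1 ?_
    linear_combination key - h
  · rintro rfl
    exact ⟨_, ⟨hint, rfl⟩, key⟩

/-- On the circle `Re(-1/τ) = -ε`, so `σ = ε - 1/τ` lies on the imaginary axis. Combining inversion
and translation gives `(1 - λ(σ)) λ(τ) = 1`. -/
lemma graphCircle_iff {ε : ℝ} (hε : ε = 1 ∨ ε = -1) {τ z : ℂ} :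
    graphCircle ε τ z ↔ (normSq τ = ε * τ.re ∧ 0 < τ.im) ∧ lam τ = z := by
  refine and_congr_right fun ⟨hn, him⟩ ↦ ?_
  have h0 : τ ≠ 0 := by
    rintro rfl
    simp at him
  have hnpos := normSq_pos_of_im_pos him
  have him' : 0 < ((ε : ℂ) + -1 / τ).im := by simpa using neg_one_div_im_pos him
  have hε2 : ε * ε = 1 := by rcases hε with rfl | rfl <;> norm_num
  have hint : (ε : ℂ) + -1 / τ ∈ fundInterior := by
    refine mem_fundInterior_of_re_eq_zero him' ?_
    rw [add_re, neg_one_div_re, ofReal_re]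
    field_simp
    rw [hn]
    linear_combination τ.re * hε2
  have hσ {σ : ℂ} : σ * τ = ε * τ - 1 ↔ σ = ε + -1 / τ := by
    constructor
    · intro h
      field_simp
      linear_combination h
    · rintro rfl
      field_simp
      ring
  have key : (1 - lam (ε + -1 / τ)) * lam τ = 1 := by
    have hS := lam_S him
    rcases hε with rfl | rfl
    · have := lam_T (neg_one_div_im_pos him)
      rw [ofReal_one, add_comm]
      rw [hS] at this
      linear_combination this
    · have := lam_T him'
      rw [show ((-1 : ℝ) : ℂ) + -1 / τ + 1 = -1 / τ by push_cast; ring, hS] at this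
      linear_combination this
  constructor
  · rintro ⟨σ, h1, w, ⟨-, rfl⟩, h2⟩
    rw [hσ] at h1
    rw [h1] at h2
    exact mul_left_cancel₀ (left_ne_zero_of_mul_eq_one key) (key.trans h2.symm)
  · rintro rfl
    exact ⟨_, hσ.mpr rfl, _, ⟨hint, rfl⟩, key⟩

lemma mem_fundRegion_iff {τ : ℂ} : τ ∈ fundRegion ↔ τ ∈ fundInterior ∨
    (τ.re = 1 ∧ 0 < τ.im) ∨ (τ.re = -1 ∧ 0 < τ.im) ∨ (normSq τ = 1 * τ.re ∧ 0 < τ.im) ∨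
      (normSq τ = -1 * τ.re ∧ 0 < τ.im) := by
  constructor
  · rintro ⟨h0, h1, h2⟩
    rcases h1.lt_or_eq with h1 | h1
    · rcases h2.lt_or_eq with h2 | h2
      · exact Or.inl ⟨h0, h1, h2⟩
      · rcases abs_choice τ.re with h | h <;> rw [h] at h2
        · exact Or.inr (Or.inr (Or.inr (Or.inl ⟨by linarith, h0⟩)))
        · exact Or.inr (Or.inr (Or.inr (Or.inr ⟨by linarith, h0⟩)))
    · rcases eq_or_eq_neg_of_abs_eq h1 with h | h
      · exact Or.inr (Or.inl ⟨h, h0⟩)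
      · exact Or.inr (Or.inr (Or.inl ⟨h, h0⟩))
  · rintro (⟨h0, h1, h2⟩ | ⟨h, h0⟩ | ⟨h, h0⟩ | ⟨h, h0⟩ | ⟨h, h0⟩)
    · exact ⟨h0, h1.le, h2.le⟩
    all_goals
      have hn := normSq_eq_add τ
      refine ⟨h0, abs_le.mpr ⟨?_, ?_⟩, abs_le.mpr ⟨?_, ?_⟩⟩ <;> nlinarith

lemma graph_iff {τ z : ℂ} : (τ ∈ fundRegion ∧ lam τ = z) ↔ graphInterior τ z ∨
    graphSide 1 τ z ∨ graphSide (-1) τ z ∨ graphCircle 1 τ z ∨ graphCircle (-1) τ z := by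
  rw [graphSide_iff (Or.inl rfl), graphSide_iff (Or.inr rfl), graphCircle_iff (Or.inl rfl),
    graphCircle_iff (Or.inr rfl), graphInterior, mem_fundRegion_iff]
  tauto

/-! ### Strong definability of the pieces of the graph -/

section

variable {α : Type} {T Z : (α → ℝ) → ℂ}

lemma isSDPred_mem_slitRegion (hZ : IsComplexTermFun Z) : IsSDPred fun a ↦ Z a ∈ slitRegion := by
  have h1 : IsSDPred fun a ↦ ¬(Z a).im = 0 := (hZ.2.eq (isTermFun_const 0)).not.isSDPred
  -- The extra condition `Im = 0` makes the two alternatives disjoint.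
  have h2 : IsSDPred fun a ↦ (Z a).im = 0 ∧ 0 < (Z a).re ∧ (Z a).re < 1 :=
    (hZ.2.eq (isTermFun_const 0)).isSDPred.and (hZ.1.pos.and (hZ.1.lt (isTermFun_const 1)))
  convert h1.or h2 (fun a h h' ↦ h h'.1) using 2 with a
  simp only [slitRegion, Set.mem_ofPred_eq]
  tauto

lemma isSDPred_mem_fundInterior (hT : IsComplexTermFun T) :
    IsSDPred fun a ↦ T a ∈ fundInterior := by
  have h := hT.2.pos.and (((isTermFun_const (-1)).lt hT.1).and ((hT.1.lt (isTermFun_const 1)).and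
    ((hT.1.neg.lt (IsTermFun.normSq hT)).and (hT.1.lt (IsTermFun.normSq hT)))))
  convert h using 2 with a
  simp only [fundInterior, Set.mem_ofPred_eq, abs_lt, neg_lt]
  tauto

lemma isSDPred_graphInterior (hT : IsComplexTermFun T) (hZ : IsComplexTermFun Z) :
    IsSDPred fun a ↦ graphInterior (T a) (Z a) := by
  have h := (isSDPred_mem_fundInterior hT).and ((isSDPred_mem_slitRegion hZ).and
    ((hZ.ellipticK.mul hT).eq ((isComplexTermFun_const I).mul
      ((isComplexTermFun_const 1).sub hZ).ellipticK)).isSDPred)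
  convert h using 2 with a
  exact and_congr_right fun h ↦ lam_eq_iff_ellipticK h

lemma isComplexTermFun_witness :
    IsComplexTermFun fun v : α ⊕ Fin 2 → ℝ ↦ ⟨v (Sum.inr 0), v (Sum.inr 1)⟩ :=
  isComplexTermFun_mk (isTermFun_var _) (isTermFun_var _)

lemma isSDPred_graphSide (ε : ℝ) (hT : IsComplexTermFun T) (hZ : IsComplexTermFun Z) :
    IsSDPred fun a ↦ graphSide ε (T a) (Z a) := by
  refine ((hT.1.eq (isTermFun_const ε)).isSDPred.and hT.2.pos).and
    (IsSDPred.exists_complex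
      (R := fun a w ↦ graphInterior (T a - ε) w ∧ w * (Z a - 1) = Z a) ?_ ?_)
  · exact (isSDPred_graphInterior ((hT.comp Sum.inl).sub (isComplexTermFun_const _))
      isComplexTermFun_witness).and ((isComplexTermFun_witness.mul
        ((hZ.comp Sum.inl).sub (isComplexTermFun_const 1))).eq (hZ.comp Sum.inl)).isSDPred
  · rintro a w w' ⟨⟨-, h⟩, -⟩ ⟨⟨-, h'⟩, -⟩
    exact h.symm.trans h'

lemma isSDPred_graphCircle (ε : ℝ) (hT : IsComplexTermFun T) (hZ : IsComplexTermFun Z) :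
    IsSDPred fun a ↦ graphCircle ε (T a) (Z a) := by
  have hdom : IsSDPred fun a ↦ normSq (T a) = ε * (T a).re ∧ 0 < (T a).im :=
    (((IsTermFun.normSq hT).eq ((isTermFun_const ε).mul hT.1)).isSDPred.and hT.2.pos)
  -- The clause `T a ≠ 0`, automatic on the circle with `Im > 0`, makes `σ` unique for every `a`.
  have hall : IsSDPred fun a ↦ ∃ σ, T a ≠ 0 ∧ σ * T a = ε * T a - 1 ∧
      ∃ w, graphInterior σ w ∧ (1 - w) * Z a = 1 := by
    refine IsSDPred.exists_complex (R := fun a σ ↦ T a ≠ 0 ∧ σ * T a = ε * T a - 1 ∧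
      ∃ w, graphInterior σ w ∧ (1 - w) * Z a = 1) ?_ ?_
    · have hT' := hT.comp (Sum.inl : α → α ⊕ Fin 2)
      refine (hT'.eq (isComplexTermFun_const 0)).not.isSDPred.and
        (((isComplexTermFun_witness.mul hT').eq (((isComplexTermFun_const ε).mul hT').sub
          (isComplexTermFun_const 1))).isSDPred.and ?_)
      refine IsSDPred.exists_complex (α := α ⊕ Fin 2)
        (R := fun v w ↦ graphInterior ⟨v (Sum.inr 0), v (Sum.inr 1)⟩ w ∧
          (1 - w) * Z (v ∘ Sum.inl) = 1) ?_ ?_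
      · exact (isSDPred_graphInterior (isComplexTermFun_witness.comp Sum.inl)
          isComplexTermFun_witness).and
          ((((isComplexTermFun_const 1).sub isComplexTermFun_witness).mul
            ((hZ.comp Sum.inl).comp Sum.inl)).eq (isComplexTermFun_const 1)).isSDPred
      · rintro a w w' ⟨⟨-, h⟩, -⟩ ⟨⟨-, h'⟩, -⟩
        exact h.symm.trans h'
    · rintro a σ σ' ⟨h0, h, -⟩ ⟨-, h', -⟩
      exact mul_right_cancel₀ h0 (h.trans h'.symm)
  convert hdom.and hall using 2 with a
  refine and_congr_right fun h ↦ exists_congr fun σ ↦ ?_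
  refine (and_iff_right ?_).symm
  intro h0
  simp [h0] at h

/-- The bounding lines and circles meet only at `0` and `±1`, outside the upper half-plane, so the
five pieces are disjoint. -/
lemma isSDPred_graph (hT : IsComplexTermFun T) (hZ : IsComplexTermFun Z) :
    IsSDPred fun a ↦ T a ∈ fundRegion ∧ lam (T a) = Z a := by
  simp only [graph_iff]
  refine (isSDPred_graphInterior hT hZ).or ((isSDPred_graphSide 1 hT hZ).or
    ((isSDPred_graphSide (-1) hT hZ).or ((isSDPred_graphCircle 1 hT hZ).or
      (isSDPred_graphCircle (-1) hT hZ) ?_) ?_) ?_) ?_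
  · rintro a ⟨⟨h1, h2⟩, -⟩ ⟨⟨h3, -⟩, -⟩
    rw [normSq_eq_add] at h1 h3
    nlinarith
  · rintro a ⟨⟨h1, h2⟩, -⟩ (⟨⟨h3, -⟩, -⟩ | ⟨⟨h3, -⟩, -⟩) <;>
    · rw [normSq_eq_add, h1] at h3
      nlinarith
  · rintro a ⟨⟨h1, h2⟩, -⟩ (⟨⟨h3, -⟩, -⟩ | ⟨⟨h3, -⟩, -⟩ | ⟨⟨h3, -⟩, -⟩)
    · linarith
    all_goals
      rw [normSq_eq_add, h1] at h3
      nlinarith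
  · rintro a ⟨⟨h0, h1, h2⟩, -⟩ (⟨⟨h3, -⟩, -⟩ | ⟨⟨h3, -⟩, -⟩ | ⟨⟨h3, -⟩, -⟩ | ⟨⟨h3, -⟩, -⟩)
    · norm_num [h3] at h1
    · norm_num [h3] at h1
    · linarith [(abs_lt.mp h2).2]
    · linarith [(abs_lt.mp h2).1]

end

lemma mem_realGraphOn_iff {f : ℍ → ℂ} {g : ℂ → ℂ → Prop} (hg : ∀ τ : ℍ, ∀ z, f τ = z ↔ g τ z)
    (a : Fin 4 → ℝ) : a ∈ realGraphOn fundSet f ↔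
      (⟨a 0, a 1⟩ : ℂ) ∈ fundRegion ∧ g ⟨a 0, a 1⟩ ⟨a 2, a 3⟩ := by
  constructor
  · rintro ⟨τ, hτ, rfl⟩
    rw [mem_fundSet_iff] at hτ
    exact ⟨hτ, (hg τ _).mp rfl⟩
  · rintro ⟨h, h'⟩
    refine ⟨⟨⟨a 0, a 1⟩, h.1⟩, (mem_fundSet_iff _).mpr h, ?_⟩
    rw [(hg _ ⟨a 2, a 3⟩).mpr h']
    funext i
    fin_cases i <;> rfl

end

theorem mainTheorem6 :
    StronglyDefinable RKLang (realGraphOn fundSet modularLambda) ∧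
      StronglyDefinable RKLang (realGraphOn fundSet modularJ) := by
  have hT : IsComplexTermFun fun a : Fin 4 → ℝ ↦ ⟨a 0, a 1⟩ :=
    isComplexTermFun_mk (isTermFun_var _) (isTermFun_var _)
  have hZ : IsComplexTermFun fun a : Fin 4 → ℝ ↦ ⟨a 2, a 3⟩ :=
    isComplexTermFun_mk (isTermFun_var _) (isTermFun_var _)
  constructor
  · refine stronglyDefinable_of_isSDPred ?_
    simp only [mem_realGraphOn_iff (f := modularLambda) (g := fun τ z ↦ lam τ = z)
      fun τ z ↦ by rw [modularLambda_eq]]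
    exact isSDPred_graph hT hZ
  · refine stronglyDefinable_of_isSDPred ?_
    -- The polynomial relation determines `j` because `λ` omits `0` and `1`.
    have hJ (τ : ℍ) (z : ℂ) : modularJ τ = z ↔
        z * (lam τ ^ 2 * (1 - lam τ) ^ 2) = 256 * (1 - lam τ + lam τ ^ 2) ^ 3 := by
      rw [← modularJ_mul]
      refine ⟨fun h ↦ by rw [h], fun h ↦ (mul_right_cancel₀ ?_ h).symm⟩
      exact mul_ne_zero (pow_ne_zero _ (lam_ne_zero τ.im_pos))
        (pow_ne_zero _ (one_sub_lam_ne_zero τ.im_pos))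
    simp only [mem_realGraphOn_iff (g := fun τ z ↦ z * (lam τ ^ 2 * (1 - lam τ) ^ 2) =
      256 * (1 - lam τ + lam τ ^ 2) ^ 3) hJ]
    -- The value `w = λ(τ)` is the auxiliary witness, unique because it is a function value.
    have h : IsSDPred fun a : Fin 4 → ℝ ↦ ∃ w : ℂ,
        ((⟨a 0, a 1⟩ : ℂ) ∈ fundRegion ∧ lam ⟨a 0, a 1⟩ = w) ∧
          (⟨a 2, a 3⟩ : ℂ) * (w ^ 2 * (1 - w) ^ 2) = 256 * (1 - w + w ^ 2) ^ 3 := by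
      refine IsSDPred.exists_complex (R := fun a w ↦
        ((⟨a 0, a 1⟩ : ℂ) ∈ fundRegion ∧ lam ⟨a 0, a 1⟩ = w) ∧
          (⟨a 2, a 3⟩ : ℂ) * (w ^ 2 * (1 - w) ^ 2) = 256 * (1 - w + w ^ 2) ^ 3) ?_ ?_
      · have hw := isComplexTermFun_witness (α := Fin 4)
        have h1 := (isComplexTermFun_const (α := Fin 4 ⊕ Fin 2) 1).sub hw
        exact (isSDPred_graph (hT.comp Sum.inl) hw).and
          (((hZ.comp Sum.inl).mul ((hw.pow 2).mul (h1.pow 2))).eq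
            ((isComplexTermFun_const 256).mul ((h1.add (hw.pow 2)).pow 3))).isSDPred
      · rintro a w w' ⟨⟨-, h⟩, -⟩ ⟨⟨-, h'⟩, -⟩
        exact h.symm.trans h'
    convert h using 2 with a
    refine ⟨fun ⟨h1, h2⟩ ↦ ⟨_, ⟨h1, rfl⟩, h2⟩, ?_⟩
    rintro ⟨_, ⟨h1, rfl⟩, h2⟩
    exact ⟨h1, h2⟩
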